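/- Use polar coordinates $(x,y)=(\rho\sin\theta,\rho\cos\theta)$ in the plane. Let $Z_2^0=\sqrt3\,(2\rho^2-1)$, $Z_4^0=\sqrt5\,(6\rho^4-6\rho^2+1)$ and $Z_n^n=\sqrt{2(n+1)}\,\rho^n\cos(n\theta)$ be the normalized Zernike polynomials. For $n\in\{3,4,5,6\}$ and $\alpha,\beta,\gamma\in\mathbb R$ let $$W=\alpha Z_2^0+\beta Z_4^0+\gamma Z_n^n,\qquad G=\det\operatorname{Hess}W .$$ A saddle cusp of Gauss inside the pupil is a point of the open unit disc at which $\nabla G=0$ and $\operatorname{Hess}G$ is indefinite, i.e. $\det\operatorname{Hess}G<0$. Let $p$ be the number of these points. By $n$ points uniformly distributed on the circle of radius $r$ we mean the points of that circle with polar angles $\theta=\varphi+2k\pi/n$, $k=0,\dots,n-1$, for some $\varphi$. Then: * if $n\in\{3,4\}$, then $p=0$ or $p=n$; * if $n\in\{5,6\}$, then $p=0$, $p=n$ or $p=2n$; * if $p=n$, the points are uniformly distributed on one circle centred at the origin, with radius $0<r<1$; * if $p=2n$, they are uniformly distributed, $n$ points on each, on two circles centred at the origin with different radii $0<r_1,r_2<1$.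 Moreover, let $\beta>0$. There is a radius $0<r<1$ such that the $n$ points of the circle of radius $r$ with angles $\theta=2k\pi/n$ are saddle cusps of Gauss if and only if (E) holds; there is such a radius for the $n$ points with angles $\theta=(2k+1)\pi/n$ if and only if (O) holds; and $p=2n$ if and only if (D) holds. The conditions are as follows. *Case $n=3$.* Put $\alpha_1^\pm=\frac{-120\beta^2\pm9\sqrt{10}\beta\gamma+3\gamma^2}{4\sqrt{15}\beta}$, $\alpha_2=\frac{60\beta^2+3\gamma^2}{4\sqrt{15}\beta}$, $\alpha_3=\frac{480\beta^2+33\gamma^2}{32\sqrt{15}\beta}$. (E): $\gamma<0$ and $\alpha_1^+<\alpha<\alpha_2$; or $0<\gamma\le4\sqrt{10}\beta$ and $\alpha_2<\alpha<\alpha_3$; or $\gamma>4\sqrt{10}\beta$ and $\alpha_2<\alpha<\alpha_1^+$. (O): $\gamma>0$ and $\alpha_1^-<\alpha<\alpha_2$; or $-4\sqrt{10}\beta\le\gamma<0$ and $\alpha_2<\alpha<\alpha_3$; or $\gamma<-4\sqrt{10}\beta$ and $\alpha_2<\alpha<\alpha_1^-$. (D): never. *Case $n=4$.* Put $\alpha_1^\pm=\frac{-60\beta^2\pm30\sqrt2\beta\gamma+15\gamma^2}{2\sqrt{15}\beta}$.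 (E): $-3\sqrt2\beta<\gamma<0$ and $\alpha_1^+<\alpha<\sqrt{15}\beta$; or $\gamma>\sqrt2\beta$ and $\sqrt{15}\beta<\alpha<\alpha_1^+$. (O): $0<\gamma<3\sqrt2\beta$ and $\alpha_1^-<\alpha<\sqrt{15}\beta$; or $\gamma<-\sqrt2\beta$ and $\sqrt{15}\beta<\alpha<\alpha_1^-$. (D): never. *Case $n=5$.* Put $\alpha_1^\pm=\frac{-60\beta^2\pm25\sqrt{15}\beta\gamma+75\gamma^2}{2\sqrt{15}\beta}$, $\delta^\pm=\frac{9(4561\pm445\sqrt{89})\beta^3}{1024\sqrt{15}\gamma^2}$, $\gamma_1^\pm=\frac{\sqrt{15}(\sqrt{89}\pm5)\beta}{40}$. *Case $n=6$.* Put $\alpha_1^\pm=\frac{-120\beta^2\pm45\sqrt{70}\beta\gamma+525\gamma^2}{4\sqrt{15}\beta}$, $\delta^\pm=\frac{\beta^2}{|\gamma|}\sqrt{\tfrac27}\,(9\pm4\sqrt3)$, $\gamma_1^\pm=\beta\,\frac{\sqrt{210}\pm\sqrt{70}}{35}$. In both cases $n=5,6$, with these parameters: (E): $\gamma\le-\gamma_1^+$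 and $\sqrt{15}\beta-\delta^+<\alpha<\sqrt{15}\beta$; or $-\gamma_1^+<\gamma<0$ and $\alpha_1^+<\alpha<\sqrt{15}\beta$; or $\gamma>\gamma_1^-$ and $\sqrt{15}\beta-\delta^-<\alpha<\alpha_1^+$. (O): $\gamma<-\gamma_1^-$ and $\sqrt{15}\beta-\delta^-<\alpha<\alpha_1^-$; or $0<\gamma<\gamma_1^+$ and $\alpha_1^-<\alpha<\sqrt{15}\beta$; or $\gamma\ge\gamma_1^+$ and $\sqrt{15}\beta-\delta^+<\alpha<\sqrt{15}\beta$. (D): $\gamma>\gamma_1^-$ and $\sqrt{15}\beta-\delta^-<\alpha<\min\{\alpha_1^+,\sqrt{15}\beta\}$; or $\gamma<-\gamma_1^-$ and $\sqrt{15}\beta-\delta^-<\alpha<\min\{\alpha_1^-,\sqrt{15}\beta\}$. -/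

import Mathlib

noncomputable section

/-- The radial Zernike polynomial `R_n^m`, for `m ≤ n` with `n - m` even. -/
def zernikeRadial (n m : ℕ) (ρ : ℝ) : ℝ :=
  ∑ s ∈ Finset.range ((n - m) / 2 + 1),
    (-1 : ℝ) ^ s * ((n - s).factorial : ℝ) /
      ((s.factorial : ℝ) * (((n + m) / 2 - s).factorial : ℝ) * (((n - m) / 2 - s).factorial : ℝ))
      * ρ ^ (n - 2 * s)

/-- The normalization factor `√(2 (n + 1) / (1 + δ_{m,0}))` of the Zernike polynomials. -/
def zernikeNorm (n m : ℕ) : ℝ :=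
  √(2 * ((n : ℝ) + 1) / (if m = 0 then 2 else 1))

/-- The normalized Zernike polynomial `Z_n^m` with `m ≥ 0` as a function of the Cartesian
coordinates `(x, y)`. The polar coordinates are `(x, y) = (ρ sin θ, ρ cos θ)`, so `ρ` and `θ`
are the modulus and the argument of the complex number `y + i x`. -/
def zernike (n m : ℕ) (p : ℝ × ℝ) : ℝ :=
  zernikeNorm n m * zernikeRadial n m (√(p.1 ^ 2 + p.2 ^ 2)) *
    Real.cos ((m : ℝ) * Complex.arg ⟨p.2, p.1⟩)

/-- The wave aberration `W = α Z_2^0 + β Z_4^0 + γ Z_n^n`. -/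
def waveAberration (n : ℕ) (α β γ : ℝ) (p : ℝ × ℝ) : ℝ :=
  α * zernike 2 0 p + β * zernike 4 0 p + γ * zernike n n p

/-- The partial derivative `∂f/∂x`. -/
def partialX (f : ℝ × ℝ → ℝ) (p : ℝ × ℝ) : ℝ := deriv (fun t => f (t, p.2)) p.1

/-- The partial derivative `∂f/∂y`. -/
def partialY (f : ℝ × ℝ → ℝ) (p : ℝ × ℝ) : ℝ := deriv (fun t => f (p.1, t)) p.2

/-- The Hessian matrix of a function of two variables. -/
def hessian (f : ℝ × ℝ → ℝ) (p : ℝ × ℝ) : Matrix (Fin 2) (Fin 2) ℝ :=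
  !![partialX (partialX f) p, partialY (partialX f) p;
     partialX (partialY f) p, partialY (partialY f) p]

/-- The Hessian determinant `det Hess f`. -/
def hessianDet (f : ℝ × ℝ → ℝ) (p : ℝ × ℝ) : ℝ := (hessian f p).det

/-- A saddle critical point: the gradient vanishes and the Hessian matrix is indefinite, that is,
it has negative determinant. -/
def IsSaddle (f : ℝ × ℝ → ℝ) (p : ℝ × ℝ) : Prop :=
  partialX f p = 0 ∧ partialY f p = 0 ∧ (hessian f p).det < 0

/-- The saddle cusps of Gauss inside the unit pupil: the saddle critical points of
`G = det Hess W` in the open unit disc. -/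
def saddleCusps (n : ℕ) (α β γ : ℝ) : Set (ℝ × ℝ) :=
  {p | p.1 ^ 2 + p.2 ^ 2 < 1 ∧ IsSaddle (hessianDet (waveAberration n α β γ)) p}

/-- The `n` points uniformly distributed on the circle of radius `r` about the origin, with
polar angles `φ + 2 π k / n` for `k = 0, …, n - 1`. -/
def uniformRing (n : ℕ) (r φ : ℝ) : Set (ℝ × ℝ) :=
  {p | ∃ k : ℕ, k < n ∧ p = (r * Real.sin (φ + 2 * Real.pi * k / n),
    r * Real.cos (φ + 2 * Real.pi * k / n))}

/-! ### Parameter regions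

The argument `s` stands for the sign `±` in `α₁^±`, `α₂^±`, `γ₁^±`. -/

/-- `α₁^±` for `n = 3, 4, 5, 6`. -/
def alphaOne (n : ℕ) (s β γ : ℝ) : ℝ :=
  match n with
  | 3 => (-120 * β ^ 2 + s * (9 * √10 * β * γ) + 3 * γ ^ 2) / (4 * √15 * β)
  | 4 => (-60 * β ^ 2 + s * (30 * √2 * β * γ) + 15 * γ ^ 2) / (2 * √15 * β)
  | 5 => (-60 * β ^ 2 + s * (25 * √15 * β * γ) + 75 * γ ^ 2) / (2 * √15 * β)
  | 6 => (-120 * β ^ 2 + s * (45 * √70 * β * γ) + 525 * γ ^ 2) / (4 * √15 * β)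
  | _ => 0

/-- `α₂` for `n = 3`. -/
def alphaTwo3 (β γ : ℝ) : ℝ := (60 * β ^ 2 + 3 * γ ^ 2) / (4 * √15 * β)

/-- `α₃` for `n = 3`. -/
def alphaThree3 (β γ : ℝ) : ℝ := (480 * β ^ 2 + 33 * γ ^ 2) / (32 * √15 * β)

/-- `α₂^±` for `n = 5`. -/
def alphaTwo5 (s β γ : ℝ) : ℝ :=
  9 * (4561 + s * (445 * √89)) * β ^ 3 / (1024 * √15 * γ ^ 2)

/-- `γ₁^±` for `n = 5`. -/
def gammaOne5 (s β : ℝ) : ℝ := √15 * (√89 + s * 5) * β / 40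

/-- `α₂^±` for `n = 6`; it has the sign of `γ` when `β > 0`. -/
def alphaTwo6 (s β γ : ℝ) : ℝ := β ^ 2 / γ * √(2 / 7) * (9 + s * (4 * √3))

/-- `γ₁^±` for `n = 6`. -/
def gammaOne6 (s β : ℝ) : ℝ := β * (√210 + s * √70) / 35

/-- The parameters with saddle cusps of Gauss at the polar angles `2 k π / n`. -/
def evenRegion (n : ℕ) (α β γ : ℝ) : Prop :=
  match n with
  | 3 =>
      (γ < 0 ∧ alphaOne 3 1 β γ < α ∧ α < alphaTwo3 β γ) ∨
      (0 < γ ∧ γ ≤ 4 * √10 * β ∧ alphaTwo3 β γ < α ∧ α < alphaThree3 β γ) ∨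
      (4 * √10 * β < γ ∧ alphaTwo3 β γ < α ∧ α < alphaOne 3 1 β γ)
  | 4 =>
      (-(3 * √2 * β) < γ ∧ γ < 0 ∧ alphaOne 4 1 β γ < α ∧ α < √15 * β) ∨
      (√2 * β < γ ∧ √15 * β < α ∧ α < alphaOne 4 1 β γ)
  | 5 =>
      (γ ≤ -gammaOne5 1 β ∧ √15 * β - alphaTwo5 1 β γ < α ∧ α < √15 * β) ∨
      (-gammaOne5 1 β < γ ∧ γ < 0 ∧ alphaOne 5 1 β γ < α ∧ α < √15 * β) ∨
      (gammaOne5 (-1) β < γ ∧ √15 * β - alphaTwo5 (-1) β γ < α ∧ α < alphaOne 5 1 β γ)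
  | 6 =>
      (γ ≤ -gammaOne6 1 β ∧ √15 * β + alphaTwo6 1 β γ < α ∧ α < √15 * β) ∨
      (-gammaOne6 1 β < γ ∧ γ < 0 ∧ alphaOne 6 1 β γ < α ∧ α < √15 * β) ∨
      (gammaOne6 (-1) β < γ ∧ √15 * β - alphaTwo6 (-1) β γ < α ∧ α < alphaOne 6 1 β γ)
  | _ => False

/-- The parameters with saddle cusps of Gauss at the polar angles `(2 k + 1) π / n`. -/
def oddRegion (n : ℕ) (α β γ : ℝ) : Prop :=
  match n with
  | 3 =>
      (0 < γ ∧ alphaOne 3 (-1) β γ < α ∧ α < alphaTwo3 β γ) ∨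
      (-(4 * √10 * β) ≤ γ ∧ γ < 0 ∧ alphaTwo3 β γ < α ∧ α < alphaThree3 β γ) ∨
      (γ < -(4 * √10 * β) ∧ alphaTwo3 β γ < α ∧ α < alphaOne 3 (-1) β γ)
  | 4 =>
      (0 < γ ∧ γ < 3 * √2 * β ∧ alphaOne 4 (-1) β γ < α ∧ α < √15 * β) ∨
      (γ < -(√2 * β) ∧ √15 * β < α ∧ α < alphaOne 4 (-1) β γ)
  | 5 =>
      (γ < -gammaOne5 (-1) β ∧ √15 * β - alphaTwo5 (-1) β γ < α ∧ α < alphaOne 5 (-1) β γ) ∨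
      (0 < γ ∧ γ < gammaOne5 1 β ∧ alphaOne 5 (-1) β γ < α ∧ α < √15 * β) ∨
      (gammaOne5 1 β ≤ γ ∧ √15 * β - alphaTwo5 1 β γ < α ∧ α < √15 * β)
  | 6 =>
      (γ < -gammaOne6 (-1) β ∧ √15 * β + alphaTwo6 (-1) β γ < α ∧ α < alphaOne 6 (-1) β γ) ∨
      (0 < γ ∧ γ < gammaOne6 1 β ∧ alphaOne 6 (-1) β γ < α ∧ α < √15 * β) ∨
      (gammaOne6 1 β ≤ γ ∧ √15 * β - alphaTwo6 1 β γ < α ∧ α < √15 * β)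
  | _ => False

/-- The parameters with saddle cusps of Gauss on two circles (only for `n = 5, 6`). -/
def doubleRegion (n : ℕ) (α β γ : ℝ) : Prop :=
  match n with
  | 5 =>
      (gammaOne5 (-1) β < γ ∧ √15 * β - alphaTwo5 (-1) β γ < α ∧
        α < min (alphaOne 5 1 β γ) (√15 * β)) ∨
      (γ < -gammaOne5 (-1) β ∧ √15 * β - alphaTwo5 (-1) β γ < α ∧
        α < min (alphaOne 5 (-1) β γ) (√15 * β))
  | 6 =>
      (γ < -gammaOne6 (-1) β ∧ √15 * β + alphaTwo6 (-1) β γ < α ∧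
        α < min (√15 * β) (alphaOne 6 (-1) β γ)) ∨
      (gammaOne6 (-1) β < γ ∧ √15 * β - alphaTwo6 (-1) β γ < α ∧
        α < min (√15 * β) (alphaOne 6 1 β γ))
  | _ => False

end

/-!
Write `z = y + i x` and `u = |z|²`. Then `W = a u² + b u + d + c Re zⁿ`, and the Hessian
determinant of such a function is again of this shape: with `k = c n (n - 1) / 2`,
`G = 4 (12 a² u² + 8 a b u + b² - k² uⁿ⁻²) - 16 a k Re zⁿ`
(`hessianDet_radialHarmonic_quadratic`). For any function `q(u) + c Re zⁿ` with `n ≥ 3` the saddle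
critical points are the points `z ≠ 0` with `zⁿ` real, `2 u q'(u) = -c n Re zⁿ` and
`q'(u) (2 u q''(u) - (n - 2) q'(u)) < 0` (`isSaddle_radialHarmonic_iff`). So the saddle cusps lie
on circles, where `zⁿ = rⁿ` or `zⁿ = -rⁿ`.

For `β ≠ 0` put `κ = k / a`, `B = b / a = α / (√15 β) - 1` and `σ = κ` or `σ = -κ` according to
the sign of `zⁿ`. The circle of radius `ρ` then carries saddle cusps exactly when the level
function `L(ρ) = (n - 2) σ² ρ^(2n - 6) + 2 n σ ρ^(n - 2) - 24 ρ²` takes the value `8 B` at `ρ`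
and `σ L'(ρ) > 0` (`mem_saddleCusps_iff_mem_uniformRing`). For `3 ≤ n ≤ 6` the sign of `L'` is that
of a polynomial of degree at most two in `w = σ ρ^(n - 4)`, so that the radii with `σ L' > 0` form
an interval. Since `σ L` is strictly increasing there, each sign of `σ` gives at most one radius
(`IsCuspRadius.unique`), and by the intermediate value theorem the radius exists exactly when `8 B`
lies strictly between the values of `L` at the ends of the interval
(`exists_isCuspRadius_iff`). Expressed through `α`, `β`, `γ` these are the stated regions.

For `n = 3, 4` the values of `L` at the admissible radii for `σ` and for `-σ` are separated by
`σ²` and by `0` respectively, so there is at most one circle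
(`not_exists_isCuspRadius_and_neg`). For `n = 5, 6` and `σ > 0`, a circle for
`σ` is accompanied by one for `-σ` exactly when `B < 0`
(`exists_isCuspRadius_neg_iff_of_pos`).
-/

/-! ### Radial functions with one harmonic -/

noncomputable section

open Polynomial

/-- The function `q(x² + y²) + c Re (y + i x)ⁿ` of `p = (x, y)`. In the polar coordinates
`(x, y) = (ρ sin θ, ρ cos θ)` it is `q(ρ²) + c ρⁿ cos (n θ)`. -/
def radialHarmonic (q : ℝ[X]) (c : ℝ) (n : ℕ) (p : ℝ × ℝ) : ℝ :=
  q.eval (p.1 ^ 2 + p.2 ^ 2) + c * ((⟨p.2, p.1⟩ : ℂ) ^ n).re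

theorem hasDerivAt_mk_left_pow (x y : ℝ) (n : ℕ) :
    HasDerivAt (fun t : ℝ => (⟨y, t⟩ : ℂ) ^ (n + 1))
      ((n + 1) * Complex.I * (⟨y, x⟩ : ℂ) ^ n) x := by
  have h : HasDerivAt (fun t : ℝ => (⟨y, t⟩ : ℂ)) Complex.I x := by
    have h0 : (fun t : ℝ => (⟨y, t⟩ : ℂ)) = fun t : ℝ => (y : ℂ) + (t : ℂ) * Complex.I := by
      funext t; apply Complex.ext <;> simp
    rw [h0]
    simpa using ((Complex.ofRealCLM.hasDerivAt (x := x)).mul_const Complex.I).const_add (y : ℂ)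
  refine (h.pow (n + 1)).congr_deriv ?_
  rw [Nat.add_sub_cancel]; push_cast; ring

theorem hasDerivAt_mk_right_pow (x y : ℝ) (n : ℕ) :
    HasDerivAt (fun t : ℝ => (⟨t, x⟩ : ℂ) ^ (n + 1)) ((n + 1) * (⟨y, x⟩ : ℂ) ^ n) y := by
  have h : HasDerivAt (fun t : ℝ => (⟨t, x⟩ : ℂ)) 1 y := by
    have h0 : (fun t : ℝ => (⟨t, x⟩ : ℂ)) = fun t : ℝ => (t : ℂ) + (x : ℂ) * Complex.I := by
      funext t; apply Complex.ext <;> simp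
    rw [h0]
    simpa using (Complex.ofRealCLM.hasDerivAt (x := y)).add_const ((x : ℂ) * Complex.I)
  refine (h.pow (n + 1)).congr_deriv ?_
  rw [Nat.add_sub_cancel]; push_cast; ring

theorem HasDerivAt.complex_re {f : ℝ → ℂ} {f' : ℂ} {x : ℝ} (h : HasDerivAt f f' x) :
    HasDerivAt (fun t => (f t).re) f'.re x := by
  exact (Complex.reCLM.hasFDerivAt.comp_hasDerivAt x h)

theorem HasDerivAt.complex_im {f : ℝ → ℂ} {f' : ℂ} {x : ℝ} (h : HasDerivAt f f' x) :
    HasDerivAt (fun t => (f t).im) f'.im x := by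
  exact (Complex.imCLM.hasFDerivAt.comp_hasDerivAt x h)

theorem hasDerivAt_eval_sq_left (q : ℝ[X]) (x y : ℝ) :
    HasDerivAt (fun t : ℝ => q.eval (t ^ 2 + y ^ 2)) (q.derivative.eval (x ^ 2 + y ^ 2) * (2 * x))
      x := by
  have := (q.hasDerivAt (x ^ 2 + y ^ 2)).comp x (((hasDerivAt_id x).pow 2).add_const (y ^ 2))
  simpa [Function.comp_def] using this

theorem hasDerivAt_eval_sq_right (q : ℝ[X]) (x y : ℝ) :
    HasDerivAt (fun t : ℝ => q.eval (x ^ 2 + t ^ 2)) (q.derivative.eval (x ^ 2 + y ^ 2) * (2 * y))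
      y := by
  simpa [add_comm] using hasDerivAt_eval_sq_left q y x

theorem partialX_radialHarmonic (q : ℝ[X]) (c : ℝ) (n : ℕ) :
    partialX (radialHarmonic q c (n + 1)) = fun p =>
      q.derivative.eval (p.1 ^ 2 + p.2 ^ 2) * (2 * p.1) -
        c * ((n + 1) * ((⟨p.2, p.1⟩ : ℂ) ^ n).im) := by
  funext ⟨x, y⟩
  have h := (hasDerivAt_eval_sq_left q x y).add
    ((hasDerivAt_mk_left_pow x y n).complex_re.const_mul c)
  refine h.deriv.trans ?_
  have : ((n + 1) * Complex.I * (⟨y, x⟩ : ℂ) ^ n).re = -((n + 1) * ((⟨y, x⟩ : ℂ) ^ n).im) := by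
    simp
  rw [this]; ring

theorem partialY_radialHarmonic (q : ℝ[X]) (c : ℝ) (n : ℕ) :
    partialY (radialHarmonic q c (n + 1)) = fun p =>
      q.derivative.eval (p.1 ^ 2 + p.2 ^ 2) * (2 * p.2) +
        c * ((n + 1) * ((⟨p.2, p.1⟩ : ℂ) ^ n).re) := by
  funext ⟨x, y⟩
  have h := (hasDerivAt_eval_sq_right q x y).add
    ((hasDerivAt_mk_right_pow x y n).complex_re.const_mul c)
  refine h.deriv.trans ?_
  simp

theorem hessian_radialHarmonic (q : ℝ[X]) (c : ℝ) (n : ℕ) (x y : ℝ) :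
    hessian (radialHarmonic q c (n + 2)) (x, y) =
      !![2 * q.derivative.eval (x ^ 2 + y ^ 2)
            + 4 * x ^ 2 * q.derivative.derivative.eval (x ^ 2 + y ^ 2)
            - c * ((n + 2) * (n + 1) * ((⟨y, x⟩ : ℂ) ^ n).re),
          4 * x * y * q.derivative.derivative.eval (x ^ 2 + y ^ 2)
            - c * ((n + 2) * (n + 1) * ((⟨y, x⟩ : ℂ) ^ n).im);
         4 * x * y * q.derivative.derivative.eval (x ^ 2 + y ^ 2)
            - c * ((n + 2) * (n + 1) * ((⟨y, x⟩ : ℂ) ^ n).im),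
          2 * q.derivative.eval (x ^ 2 + y ^ 2)
            + 4 * y ^ 2 * q.derivative.derivative.eval (x ^ 2 + y ^ 2)
            + c * ((n + 2) * (n + 1) * ((⟨y, x⟩ : ℂ) ^ n).re)] := by
  have e1 : ((n + 1) * Complex.I * (⟨y, x⟩ : ℂ) ^ n).re = -((n + 1) * ((⟨y, x⟩ : ℂ) ^ n).im) := by
    simp
  have e2 : ((n + 1) * Complex.I * (⟨y, x⟩ : ℂ) ^ n).im = (n + 1) * ((⟨y, x⟩ : ℂ) ^ n).re := by
    simp [Complex.mul_im]
  have e3 : ((n + 1) * (⟨y, x⟩ : ℂ) ^ n).re = (n + 1) * ((⟨y, x⟩ : ℂ) ^ n).re := by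
    simp
  have e4 : ((n + 1) * (⟨y, x⟩ : ℂ) ^ n).im = (n + 1) * ((⟨y, x⟩ : ℂ) ^ n).im := by
    simp
  have lx : HasDerivAt (fun t : ℝ => 2 * t) 2 x := by
    simpa using (hasDerivAt_id x).const_mul (2 : ℝ)
  have ly : HasDerivAt (fun t : ℝ => 2 * t) 2 y := by
    simpa using (hasDerivAt_id y).const_mul (2 : ℝ)
  have hX := hasDerivAt_mk_left_pow x y n
  have hY := hasDerivAt_mk_right_pow x y n
  unfold hessian
  rw [partialX_radialHarmonic q c (n + 1), partialY_radialHarmonic q c (n + 1)]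
  ext i j
  fin_cases i <;> fin_cases j
  · refine (((hasDerivAt_eval_sq_left q.derivative x y).mul lx).sub
      ((hX.complex_im.const_mul _).const_mul c)).deriv.trans ?_
    rw [e2]; simp; ring
  · refine (((hasDerivAt_eval_sq_right q.derivative x y).mul_const (2 * x)).sub
      ((hY.complex_im.const_mul _).const_mul c)).deriv.trans ?_
    rw [e4]; simp; ring
  · refine (((hasDerivAt_eval_sq_left q.derivative x y).mul_const (2 * y)).add
      ((hX.complex_re.const_mul _).const_mul c)).deriv.trans ?_
    rw [e1]; simp; ring
  · refine (((hasDerivAt_eval_sq_right q.derivative x y).mul ly).add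
      ((hY.complex_re.const_mul _).const_mul c)).deriv.trans ?_
    rw [e3]; simp; ring

theorem re_sq_add_im_sq_mk_pow (x y : ℝ) (n : ℕ) :
    ((⟨y, x⟩ : ℂ) ^ n).re ^ 2 + ((⟨y, x⟩ : ℂ) ^ n).im ^ 2 = (x ^ 2 + y ^ 2) ^ n := by
  have := map_pow Complex.normSq (⟨y, x⟩ : ℂ) n
  rw [Complex.normSq_apply, Complex.normSq_apply] at this
  rw [show x ^ 2 + y ^ 2 = y * y + x * x by ring, ← this]; ring

/-- The Hessian determinant stays in the class of functions `q(|z|²) + c Re zⁿ`: it is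
`4 (W_{z z̄}² - |W_{zz}|²)`, whose only part that is not radial is a multiple of `Re (z² zⁿ⁻²)`. -/
theorem hessianDet_radialHarmonic_quadratic (a b d c : ℝ) (m : ℕ) :
    hessianDet (radialHarmonic (C a * X ^ 2 + C b * X + C d) c (m + 3)) =
      radialHarmonic
        (C (48 * a ^ 2) * X ^ 2 + C (32 * a * b) * X + C (4 * b ^ 2)
          - C ((c * (m + 3) * (m + 2)) ^ 2) * X ^ (m + 1))
        (-(8 * a * (c * (m + 3) * (m + 2)))) (m + 3) := by
  funext ⟨x, y⟩
  have hm := hessian_radialHarmonic (C a * X ^ 2 + C b * X + C d) c (m + 1) x y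
  have hn := re_sq_add_im_sq_mk_pow x y (m + 1)
  have h3 : ((⟨y, x⟩ : ℂ) ^ (m + 3)).re = ((⟨y, x⟩ : ℂ) ^ (m + 1)).re * (y ^ 2 - x ^ 2)
      - ((⟨y, x⟩ : ℂ) ^ (m + 1)).im * (2 * x * y) := by
    rw [show m + 3 = (m + 1) + 2 by ring, pow_add _ (m + 1), Complex.mul_re, pow_two (⟨y, x⟩ : ℂ)]
    simp; ring
  rw [hessianDet, show m + 3 = m + 1 + 2 by ring, hm, Matrix.det_fin_two_of]
  unfold radialHarmonic
  simp only [← hn, show m + 1 + 2 = m + 3 by ring, h3, eval_sub, eval_add, eval_mul, eval_C,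
    eval_pow, eval_X, derivative_add, derivative_mul, derivative_C, derivative_X_pow, derivative_X,
    eval_zero, derivative_one, derivative_zero, map_natCast]
  push_cast
  norm_num
  ring

/-- The saddle critical points of `q(u) + c Re zⁿ`, where `u = |z|²` and `n = m + 3`. The vanishing
of the gradient says `2 q'(u) z + c n z̄ⁿ⁻¹ = 0`; at such a point other than the origin the Hessian
determinant is `4 n q' (2 u q'' - (n - 2) q')`, and at the origin it is `4 q'(0)² ≥ 0`. -/
theorem isSaddle_radialHarmonic_iff (q : ℝ[X]) (c : ℝ) (m : ℕ) (x y : ℝ) :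
    IsSaddle (radialHarmonic q c (m + 3)) (x, y) ↔
      0 < x ^ 2 + y ^ 2 ∧ ((⟨y, x⟩ : ℂ) ^ (m + 3)).im = 0 ∧
      2 * (x ^ 2 + y ^ 2) * q.derivative.eval (x ^ 2 + y ^ 2)
        = -(c * (m + 3) * ((⟨y, x⟩ : ℂ) ^ (m + 3)).re) ∧
      q.derivative.eval (x ^ 2 + y ^ 2) *
        (2 * (x ^ 2 + y ^ 2) * q.derivative.derivative.eval (x ^ 2 + y ^ 2)
          - (m + 1) * q.derivative.eval (x ^ 2 + y ^ 2)) < 0 := by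
  have hm := hessian_radialHarmonic q c (m + 1) x y
  have hn1 := re_sq_add_im_sq_mk_pow x y (m + 1)
  have hz2 : (⟨y, x⟩ : ℂ) ^ (m + 2) = (⟨y, x⟩ : ℂ) ^ (m + 1) * ⟨y, x⟩ := pow_succ _ _
  have hz3 : (⟨y, x⟩ : ℂ) ^ (m + 3) = (⟨y, x⟩ : ℂ) ^ (m + 2) * ⟨y, x⟩ := pow_succ _ _
  have r2 : ((⟨y, x⟩ : ℂ) ^ (m + 2)).re =
    ((⟨y, x⟩ : ℂ) ^ (m + 1)).re * y - ((⟨y, x⟩ : ℂ) ^ (m + 1)).im * x := by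
    rw [hz2, Complex.mul_re]
  have i2 : ((⟨y, x⟩ : ℂ) ^ (m + 2)).im =
    ((⟨y, x⟩ : ℂ) ^ (m + 1)).re * x + ((⟨y, x⟩ : ℂ) ^ (m + 1)).im * y := by
    rw [hz2, Complex.mul_im]
  have r3 : ((⟨y, x⟩ : ℂ) ^ (m + 3)).re =
    ((⟨y, x⟩ : ℂ) ^ (m + 2)).re * y - ((⟨y, x⟩ : ℂ) ^ (m + 2)).im * x := by
    rw [hz3, Complex.mul_re]
  have i3 : ((⟨y, x⟩ : ℂ) ^ (m + 3)).im =
    ((⟨y, x⟩ : ℂ) ^ (m + 2)).re * x + ((⟨y, x⟩ : ℂ) ^ (m + 2)).im * y := by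
    rw [hz3, Complex.mul_im]
  unfold IsSaddle
  rw [show m + 3 = m + 1 + 2 by ring, hm, Matrix.det_fin_two_of,
    partialX_radialHarmonic q c (m + 2), partialY_radialHarmonic q c (m + 2),
    show m + 1 + 2 = m + 3 by ring, r3, i3]
  push_cast
  simp only [r2, i2] at *
  generalize ((⟨y, x⟩ : ℂ) ^ (m + 1)).re = v at *
  generalize ((⟨y, x⟩ : ℂ) ^ (m + 1)).im = w at *
  generalize q.derivative.eval (x ^ 2 + y ^ 2) = D
  generalize q.derivative.derivative.eval (x ^ 2 + y ^ 2) = E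
  have hm0 : (0 : ℝ) ≤ m := Nat.cast_nonneg m
  generalize (m : ℝ) = M at *
  -- With `u = |z|²`, the determinant is `((2D + 2uE)² u² - |2Eu² + K zⁿ|²) / u²`,
  -- where `K = c n (n - 1)`, and at a critical point `K zⁿ = -2 (n - 1) u D`.
  have key : ∀ P Q : ℝ, P = v * y - w * x → Q = v * x + w * y →
      c * (P * x + Q * y) = 0 →
      2 * (x ^ 2 + y ^ 2) * D = -(c * (M + 3) * (P * y - Q * x)) →
      (x ^ 2 + y ^ 2) ^ 2 *
        ((2 * D + 4 * x ^ 2 * E - c * ((M + 1 + 2) * (M + 1 + 1) * v)) *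
          (2 * D + 4 * y ^ 2 * E + c * ((M + 1 + 2) * (M + 1 + 1) * v)) -
          (4 * x * y * E - c * ((M + 1 + 2) * (M + 1 + 1) * w)) *
          (4 * x * y * E - c * ((M + 1 + 2) * (M + 1 + 1) * w))) =
      (x ^ 2 + y ^ 2) ^ 2 * (4 * (M + 3)) *
        (D * (2 * (x ^ 2 + y ^ 2) * E - (M + 1) * D)) := by
    intro P Q hP hQ h1 h2
    have e : (x ^ 2 + y ^ 2) ^ 2 *
        ((2 * D + 4 * x ^ 2 * E - c * ((M + 1 + 2) * (M + 1 + 1) * v)) *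
          (2 * D + 4 * y ^ 2 * E + c * ((M + 1 + 2) * (M + 1 + 1) * v)) -
          (4 * x * y * E - c * ((M + 1 + 2) * (M + 1 + 1) * w)) *
          (4 * x * y * E - c * ((M + 1 + 2) * (M + 1 + 1) * w))) =
        (x ^ 2 + y ^ 2) ^ 2 * (2 * D + 2 * (x ^ 2 + y ^ 2) * E) ^ 2
          - (2 * E * (x ^ 2 + y ^ 2) ^ 2 + (M + 2) * (c * (M + 3) * (P * y - Q * x))) ^ 2
          - ((M + 3) * (M + 2) * (c * (P * x + Q * y))) ^ 2 := by
      rw [hP, hQ]; ring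
    rw [e, h1, show c * (M + 3) * (P * y - Q * x) = -(2 * (x ^ 2 + y ^ 2) * D) by linarith]
    ring
  have key := key _ _ rfl rfl
  generalize hP : v * y - w * x = P at *
  generalize hQ : v * x + w * y = Q at *
  constructor
  · rintro ⟨g1, g2, g3⟩
    have hu : 0 < x ^ 2 + y ^ 2 := by
      rcases (by positivity : 0 ≤ x ^ 2 + y ^ 2).lt_or_eq with h | h
      · exact h
      · have hx : x = 0 := by nlinarith [sq_nonneg x, sq_nonneg y]
        have hy : y = 0 := by nlinarith [sq_nonneg x, sq_nonneg y]
        rw [← h, zero_pow (by omega)] at hn1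
        have hv : v = 0 := by nlinarith [sq_nonneg v, sq_nonneg w]
        have hw : w = 0 := by nlinarith [sq_nonneg v, sq_nonneg w]
        rw [hx, hy, hv, hw] at g3
        nlinarith [sq_nonneg D]
    have h1 : c * (P * x + Q * y) = 0 := by
      have : (M + 3) * (c * (P * x + Q * y)) = 0 := by linear_combination x * g2 - y * g1
      rcases mul_eq_zero.1 this with h | h
      · linarith
      · exact h
    have h2 : 2 * (x ^ 2 + y ^ 2) * D = -(c * (M + 3) * (P * y - Q * x)) := by
      linear_combination x * g1 + y * g2
    have h3 : D * (2 * (x ^ 2 + y ^ 2) * E - (M + 1) * D) < 0 := by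
      have := mul_neg_of_pos_of_neg (pow_pos hu 2) g3
      rw [key h1 h2] at this
      exact neg_of_mul_neg_right this (by positivity)
    refine ⟨hu, (mul_eq_zero.1 h1).resolve_left ?_, h2, h3⟩
    rintro rfl
    have hD : D = 0 := by
      have : (x ^ 2 + y ^ 2) * D = 0 := by linarith
      exact (mul_eq_zero.1 this).resolve_left hu.ne'
    rw [hD] at h3; simp at h3
  · rintro ⟨hu, h1, h2, h3⟩
    refine ⟨?_, ?_, ?_⟩
    · apply (mul_eq_zero.1 (?_ : (x ^ 2 + y ^ 2) * _ = 0)).resolve_left hu.ne'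
      linear_combination x * h2 - c * (M + 3) * y * h1
    · apply (mul_eq_zero.1 (?_ : (x ^ 2 + y ^ 2) * _ = 0)).resolve_left hu.ne'
      linear_combination y * h2 + c * (M + 3) * x * h1
    · have : (x ^ 2 + y ^ 2) ^ 2 * (4 * (M + 3)) *
        (D * (2 * (x ^ 2 + y ^ 2) * E - (M + 1) * D)) < 0 :=
        mul_neg_of_pos_of_neg (by positivity) h3
      rw [← key (by rw [h1, mul_zero]) h2] at this
      exact neg_of_mul_neg_right this (by positivity)

/-! ### Wave aberrations and their saddle cusps -/

theorem zernike_two_zero (p : ℝ × ℝ) :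
    zernike 2 0 p = √3 * (2 * (p.1 ^ 2 + p.2 ^ 2) - 1) := by
  have h : √(p.1 ^ 2 + p.2 ^ 2) ^ 2 = p.1 ^ 2 + p.2 ^ 2 := Real.sq_sqrt (by positivity)
  have e : zernikeNorm 2 0 = √3 := by unfold zernikeNorm; norm_num
  simp only [zernike, e]
  simp [zernikeRadial, Finset.sum_range_succ, Nat.factorial, h]
  ring

theorem zernike_four_zero (p : ℝ × ℝ) :
    zernike 4 0 p =
      √5 * (6 * (p.1 ^ 2 + p.2 ^ 2) ^ 2 - 6 * (p.1 ^ 2 + p.2 ^ 2) + 1) := by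
  have h : √(p.1 ^ 2 + p.2 ^ 2) ^ 2 = p.1 ^ 2 + p.2 ^ 2 := Real.sq_sqrt (by positivity)
  have h4 : √(p.1 ^ 2 + p.2 ^ 2) ^ 4 = (p.1 ^ 2 + p.2 ^ 2) ^ 2 := by
    rw [show 4 = 2 * 2 by rfl, pow_mul, h]
  have e : zernikeNorm 4 0 = √5 := by unfold zernikeNorm; norm_num
  simp only [zernike, e]
  simp [zernikeRadial, Finset.sum_range_succ, Nat.factorial, h, h4]
  ring

theorem norm_pow_mul_cos_arg (z : ℂ) (n : ℕ) :
    ‖z‖ ^ n * Real.cos (n * z.arg) = (z ^ n).re := by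
  conv_rhs => rw [← Complex.norm_mul_cos_add_sin_mul_I z, mul_pow, Complex.cos_add_sin_mul_I_pow]
  rw [← Complex.ofReal_pow, Complex.re_ofReal_mul]
  congr 1
  rw [← Complex.ofReal_natCast, ← Complex.ofReal_mul, ← Complex.ofReal_cos, ← Complex.ofReal_sin]
  rw [Complex.add_re, Complex.mul_I_re, Complex.ofReal_re, Complex.ofReal_im, neg_zero, add_zero]

theorem norm_mk_eq (x y : ℝ) : ‖(⟨y, x⟩ : ℂ)‖ = √(x ^ 2 + y ^ 2) := by
  rw [Complex.norm_eq_sqrt_sq_add_sq, add_comm]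

theorem zernike_self {n : ℕ} (hn : n ≠ 0) (p : ℝ × ℝ) :
    zernike n n p = √(2 * (n + 1)) * ((⟨p.2, p.1⟩ : ℂ) ^ n).re := by
  have e : zernikeRadial n n (√(p.1 ^ 2 + p.2 ^ 2)) = √(p.1 ^ 2 + p.2 ^ 2) ^ n := by
    have : ((n.factorial : ℕ) : ℝ) ≠ 0 := by exact_mod_cast n.factorial_ne_zero
    simp [zernikeRadial, this, ← two_mul]
  rw [zernike, e, ← norm_mk_eq, mul_assoc, norm_pow_mul_cos_arg, zernikeNorm, if_neg hn, div_one]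

theorem waveAberration_eq_radialHarmonic {n : ℕ} (hn : n ≠ 0) (α β γ : ℝ) :
    waveAberration n α β γ = radialHarmonic
      (C (6 * √5 * β) * X ^ 2 + C (2 * √3 * α - 6 * √5 * β) * X + C (√5 * β - √3 * α))
      (γ * √(2 * (n + 1))) n := by
  funext p
  rw [waveAberration, zernike_two_zero, zernike_four_zero, zernike_self hn, radialHarmonic]
  simp only [eval_add, eval_mul, eval_C, eval_pow, eval_X]
  ring

/-- The level function `L(ρ) = (n - 2) σ² ρ^(2n - 6) + 2 n σ ρ^(n - 2) - 24 ρ²` for `n = m + 3`.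
For `σ = ± κ ≠ 0`, the points with `zⁿ = ± ρⁿ` are critical points of `G` exactly when
`L(ρ) = 8 B`. -/
def cuspLevel (m : ℕ) (σ ρ : ℝ) : ℝ :=
  (m + 1) * σ ^ 2 * ρ ^ (2 * m) + 2 * (m + 3) * σ * ρ ^ (m + 1) - 24 * ρ ^ 2

/-- The function `σ ρ L'(ρ) / 2`, where `L = cuspLevel m σ`. A critical point of `G` is a saddle
when it is positive. -/
def cuspSlope (m : ℕ) (σ ρ : ℝ) : ℝ :=
  σ * ((m + 1) * m * σ ^ 2 * ρ ^ (2 * m) + (m + 1) * (m + 3) * σ * ρ ^ (m + 1) - 24 * ρ ^ 2)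

/-- The radius `ρ` of a circle inside the unit pupil that carries saddle cusps, in terms of the
normalized parameters `B` and `σ`, with `n = m + 3`. -/
def IsCuspRadius (m : ℕ) (B σ ρ : ℝ) : Prop :=
  0 < ρ ∧ ρ < 1 ∧ cuspLevel m σ ρ = 8 * B ∧ 0 < cuspSlope m σ ρ

/-- The ratio `B = b / a` of the coefficients of `u` and `u²` in `W = a u² + b u + d + c Re zⁿ`. -/
def defocusRatio (α β : ℝ) : ℝ := (2 * √3 * α - 6 * √5 * β) / (6 * √5 * β)

/-- The ratio `κ = c n (n - 1) / (2 a)` of the coefficients in `W = a u² + b u + d + c Re zⁿ`,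
with `n = m + 3`. -/
def harmonicRatio (m : ℕ) (β γ : ℝ) : ℝ :=
  γ * √(2 * ((m + 3 : ℕ) + 1)) * (m + 3) * (m + 2) / (2 * (6 * √5 * β))

/-- The saddle cusps are the points `z` with `zⁿ = ε rⁿ`, `ε = ±1`, where `r = |z|` is a cusp
radius for `σ = ε κ`. There are none for `β = 0`, since then `G` is radial. -/
theorem mem_saddleCusps_iff (m : ℕ) (α β γ x y : ℝ) :
    (x, y) ∈ saddleCusps (m + 3) α β γ ↔
      β ≠ 0 ∧ ∃ ε r : ℝ, (ε = 1 ∨ ε = -1) ∧ r ^ 2 = x ^ 2 + y ^ 2 ∧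
        (⟨y, x⟩ : ℂ) ^ (m + 3) = ((ε * r ^ (m + 3) : ℝ) : ℂ) ∧
        IsCuspRadius m (defocusRatio α β) (ε * harmonicRatio m β γ) r := by
  rw [saddleCusps, Set.mem_ofPred_eq, waveAberration_eq_radialHarmonic (by omega),
    hessianDet_radialHarmonic_quadratic, isSaddle_radialHarmonic_iff]
  by_cases hβ : β = 0
  · subst hβ
    simp only [ne_eq, not_true_eq_false, false_and, iff_false]
    rintro ⟨-, hu, -, h2, h3⟩
    simp only [mul_zero, zero_mul, neg_zero, mul_eq_zero, hu.ne', OfNat.ofNat_ne_zero,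
      false_or] at h2 h3
    rw [h2] at h3
    simp at h3
  have h5 : √5 ≠ 0 := by positivity
  have hb : 2 * √3 * α - 6 * √5 * β = 6 * √5 * β * defocusRatio α β := by
    unfold defocusRatio; field_simp
  have hk : γ * √(2 * ((m + 3 : ℕ) + 1)) * (m + 3) * (m + 2)
      = 2 * (6 * √5 * β) * harmonicRatio m β γ := by
    unfold harmonicRatio; field_simp
  rw [hb, hk]
  have ha : 6 * √5 * β ≠ 0 := by positivity
  generalize 6 * √5 * β = a at *
  generalize defocusRatio α β = B
  generalize harmonicRatio m β γ = κ
  simp only [ne_eq, hβ, not_false_eq_true, true_and]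
  -- the derivatives of the radial part of `G`
  have hD : ∀ u : ℝ, (derivative (C (48 * a ^ 2) * X ^ 2 + C (32 * a * (a * B)) * X +
      C (4 * (a * B) ^ 2) - C ((2 * a * κ) ^ 2) * X ^ (m + 1))).eval u =
      4 * a ^ 2 * (24 * u + 8 * B - (m + 1) * κ ^ 2 * u ^ m) := by
    intro u
    simp only [derivative_add, derivative_sub, derivative_mul, derivative_C, derivative_X_pow,
      derivative_X, eval_add, eval_sub, eval_mul, eval_C, eval_pow, eval_X, eval_zero, eval_one,
      map_natCast, eval_natCast, Nat.add_sub_cancel]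
    push_cast; ring
  have hE : ∀ u : ℝ, u * (derivative (derivative (C (48 * a ^ 2) * X ^ 2 +
      C (32 * a * (a * B)) * X +
      C (4 * (a * B) ^ 2) - C ((2 * a * κ) ^ 2) * X ^ (m + 1)))).eval u =
      4 * a ^ 2 * (24 * u - (m + 1) * m * κ ^ 2 * u ^ m) := by
    intro u
    have hmu : (m : ℝ) * (u ^ (m - 1) * u) = m * u ^ m := by
      rcases m with _ | m
      · simp
      · rw [Nat.add_sub_cancel, ← pow_succ]
    simp only [derivative_add, derivative_sub, derivative_mul, derivative_C, derivative_X_pow,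
      derivative_X, eval_add, eval_sub, eval_mul, eval_C, eval_pow, eval_X, eval_zero, eval_one,
      map_natCast, eval_natCast, Nat.add_sub_cancel, derivative_one, derivative_natCast,
      derivative_zero]
    push_cast
    linear_combination (-4 * a ^ 2 * κ ^ 2 * (m + 1)) * hmu
  rw [hD, show ∀ t : ℝ, 2 * (x ^ 2 + y ^ 2) * t = 2 * ((x ^ 2 + y ^ 2) * t) by intro t; ring,
    show ∀ t : ℝ, 2 * (x ^ 2 + y ^ 2) * t = 2 * ((x ^ 2 + y ^ 2) * t) by intro t; ring, hE]
  have hm0 : (0 : ℝ) ≤ m := Nat.cast_nonneg m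
  -- on a circle of radius `r` with `zⁿ = ± rⁿ` the conditions are those on `r`
  have key : ∀ ε r : ℝ, (ε = 1 ∨ ε = -1) → 0 < r →
      ((2 * (r ^ 2 * (4 * a ^ 2 * (24 * r ^ 2 + 8 * B - (m + 1) * κ ^ 2 * (r ^ 2) ^ m))) =
        -(-(8 * a * (2 * a * κ)) * (m + 3) * (ε * r ^ (m + 3))) ∧
        4 * a ^ 2 * (24 * r ^ 2 + 8 * B - (m + 1) * κ ^ 2 * (r ^ 2) ^ m) *
          (2 * (4 * a ^ 2 * (24 * r ^ 2 - (m + 1) * m * κ ^ 2 * (r ^ 2) ^ m)) -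
            (m + 1) * (4 * a ^ 2 * (24 * r ^ 2 + 8 * B - (m + 1) * κ ^ 2 * (r ^ 2) ^ m))) < 0) ↔
        (cuspLevel m (ε * κ) r = 8 * B ∧ 0 < cuspSlope m (ε * κ) r)) := by
    intro ε r hε hr
    have hε2 : ε ^ 2 = 1 := by rcases hε with rfl | rfl <;> norm_num
    have e1 : (2 * (r ^ 2 * (4 * a ^ 2 * (24 * r ^ 2 + 8 * B - (m + 1) * κ ^ 2 * (r ^ 2) ^ m))) =
        -(-(8 * a * (2 * a * κ)) * (m + 3) * (ε * r ^ (m + 3)))) ↔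
        cuspLevel m (ε * κ) r = 8 * B := by
      have : 2 * (r ^ 2 * (4 * a ^ 2 * (24 * r ^ 2 + 8 * B - (m + 1) * κ ^ 2 * (r ^ 2) ^ m))) -
          -(-(8 * a * (2 * a * κ)) * (m + 3) * (ε * r ^ (m + 3))) =
          -(8 * a ^ 2 * r ^ 2) * (cuspLevel m (ε * κ) r - 8 * B) := by
        rw [cuspLevel, mul_pow ε, hε2, pow_mul r 2 m]; ring
      rw [← sub_eq_zero, this, mul_eq_zero, sub_eq_zero]
      exact or_iff_right (neg_ne_zero.2 (by positivity))
    rw [e1]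
    refine and_congr_right fun h => ?_
    have e2 : 24 * r ^ 2 + 8 * B - (m + 1) * κ ^ 2 * (r ^ 2) ^ m
        = 2 * (m + 3) * (ε * κ) * r ^ (m + 1) := by
      rw [← h, cuspLevel, mul_pow ε, hε2, pow_mul r 2 m]; ring
    rw [e2, cuspSlope]
    have e3 : 4 * a ^ 2 * (2 * (m + 3) * (ε * κ) * r ^ (m + 1)) *
          (2 * (4 * a ^ 2 * (24 * r ^ 2 - (m + 1) * m * κ ^ 2 * (r ^ 2) ^ m)) -
            (m + 1) * (4 * a ^ 2 * (2 * (m + 3) * (ε * κ) * r ^ (m + 1)))) =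
        -(64 * a ^ 4 * (m + 3) * r ^ (m + 1)) * (ε * κ * ((m + 1) * m * (ε * κ) ^ 2 * r ^ (2 * m) +
          (m + 1) * (m + 3) * (ε * κ) * r ^ (m + 1) - 24 * r ^ 2)) := by
      rw [mul_pow ε, hε2, pow_mul r 2 m]; ring
    rw [e3, neg_mul, neg_lt_zero, mul_pos_iff_of_pos_left (by positivity)]
  constructor
  · rintro ⟨hlt, hu, him, h2, h3⟩
    set r := √(x ^ 2 + y ^ 2)
    have hr : 0 < r := Real.sqrt_pos.2 hu
    have hr2 : r ^ 2 = x ^ 2 + y ^ 2 := Real.sq_sqrt hu.le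
    have hre : ∃ ε : ℝ, (ε = 1 ∨ ε = -1) ∧ ((⟨y, x⟩ : ℂ) ^ (m + 3)).re = ε * r ^ (m + 3) := by
      have h : ((⟨y, x⟩ : ℂ) ^ (m + 3)).re ^ 2 = (r ^ (m + 3)) ^ 2 := by
        rw [← pow_mul, mul_comm (m + 3), pow_mul, hr2, ← re_sq_add_im_sq_mk_pow, him]
        ring
      rcases sq_eq_sq_iff_eq_or_eq_neg.1 h with h | h
      · exact ⟨1, Or.inl rfl, by rw [h, one_mul]⟩
      · exact ⟨-1, Or.inr rfl, by rw [h]; ring⟩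
    obtain ⟨ε, hε, hre⟩ := hre
    rw [hre, ← hr2] at h2
    rw [← hr2] at h3
    obtain ⟨h4, h5⟩ := (key ε r hε hr).1 ⟨h2, h3⟩
    refine ⟨ε, r, hε, hr2, ?_, hr, ?_, h4, h5⟩
    · apply Complex.ext
      · rw [hre, Complex.ofReal_re]
      · rw [him, Complex.ofReal_im]
    · rw [← hr2] at hlt
      nlinarith
  · rintro ⟨ε, r, hε, hr2, hz, hr, hr1, h4, h5⟩
    rw [hz, Complex.ofReal_re, Complex.ofReal_im, ← hr2]
    exact ⟨by nlinarith, by positivity, rfl, (key ε r hε hr).2 ⟨h4, h5⟩⟩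

end

/-! ### Rings of uniformly distributed points -/

theorem mk_eq_mul_exp (r θ : ℝ) :
    (⟨r * Real.cos θ, r * Real.sin θ⟩ : ℂ) = r * Complex.exp (θ * Complex.I) := by
  apply Complex.ext
  · rw [Complex.re_ofReal_mul, Complex.exp_ofReal_mul_I_re]
  · rw [Complex.im_ofReal_mul, Complex.exp_ofReal_mul_I_im]

/-- The points of a ring are the `n`-th roots of `rⁿ e^(i n φ)`. -/
theorem mem_uniformRing_iff {n : ℕ} (hn : n ≠ 0) {r : ℝ} (hr : 0 < r) (φ x y : ℝ) :
    (x, y) ∈ uniformRing n r φ ↔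
      (⟨y, x⟩ : ℂ) ^ n = r ^ n * Complex.exp ((n * φ : ℝ) * Complex.I) := by
  have hnR : (n : ℝ) ≠ 0 := by exact_mod_cast hn
  have hnC : (n : ℂ) ≠ 0 := by exact_mod_cast hn
  constructor
  · rintro ⟨k, -, hk⟩
    obtain ⟨rfl, rfl⟩ := Prod.mk.inj hk
    rw [mk_eq_mul_exp, mul_pow, ← Complex.exp_nat_mul]
    congr 1
    rw [Complex.exp_eq_exp_iff_exists_int]
    refine ⟨k, ?_⟩
    push_cast
    field_simp
  · intro h
    have hnorm : ‖(⟨y, x⟩ : ℂ)‖ = r := by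
      have := congrArg norm h
      rw [norm_pow, norm_mul, Complex.norm_exp_ofReal_mul_I, mul_one, norm_pow,
        Complex.norm_of_nonneg hr.le] at this
      exact (pow_left_inj₀ (norm_nonneg _) hr.le hn).1 this
    obtain ⟨θ, hz⟩ : ∃ θ : ℝ, (⟨y, x⟩ : ℂ) = ⟨r * Real.cos θ, r * Real.sin θ⟩ := by
      refine ⟨Complex.arg ⟨y, x⟩, ?_⟩
      rw [mk_eq_mul_exp, ← hnorm, Complex.norm_mul_exp_arg_mul_I]
    rw [hz, mk_eq_mul_exp, mul_pow, ← Complex.exp_nat_mul] at h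
    have h := mul_left_cancel₀ (pow_ne_zero n (Complex.ofReal_ne_zero.2 hr.ne')) h
    rw [Complex.exp_eq_exp_iff_exists_int] at h
    obtain ⟨j, hj⟩ := h
    have hθ : θ = φ + 2 * Real.pi * j / n := by
      have hI : (n * θ : ℂ) = n * φ + j * (2 * Real.pi) := by
        apply mul_right_cancel₀ Complex.I_ne_zero
        push_cast at hj
        linear_combination hj
      have hR : (n * θ : ℝ) = n * φ + j * (2 * Real.pi) := by exact_mod_cast hI
      field_simp
      linear_combination hR
    have hn0 : (0 : ℤ) < n := by exact_mod_cast Nat.pos_of_ne_zero hn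
    have hmod := Int.emod_nonneg j hn0.ne'
    -- the angle is `φ + 2 π j / n` with an integer `j`, which is reduced modulo `n`
    refine ⟨(j % n).toNat, ?_, ?_⟩
    · have := Int.emod_lt_of_pos j hn0
      omega
    · have hcast : (((j % n).toNat : ℕ) : ℝ) = j - n * ((j / n : ℤ) : ℝ) := by
        have h1 : (((j % n).toNat : ℕ) : ℤ) = j - n * (j / n) := by
          rw [Int.toNat_of_nonneg hmod, Int.emod_def]
        exact_mod_cast h1
      have hangle : φ + 2 * Real.pi * ((j % n).toNat : ℕ) / n
          = θ - (j / n : ℤ) * (2 * Real.pi) := by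
        rw [hcast, hθ]; field_simp; ring
      rw [hangle, Real.sin_sub_int_mul_two_pi, Real.cos_sub_int_mul_two_pi]
      obtain ⟨h1, h2⟩ := Complex.mk.inj hz
      rw [h1, h2]

theorem mem_uniformRing_zero_iff {n : ℕ} (hn : n ≠ 0) {r : ℝ} (hr : 0 < r) (x y : ℝ) :
    (x, y) ∈ uniformRing n r 0 ↔ (⟨y, x⟩ : ℂ) ^ n = ((r ^ n : ℝ) : ℂ) := by
  rw [mem_uniformRing_iff hn hr]; simp

theorem mem_uniformRing_pi_div_iff {n : ℕ} (hn : n ≠ 0) {r : ℝ} (hr : 0 < r) (x y : ℝ) :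
    (x, y) ∈ uniformRing n r (Real.pi / n) ↔ (⟨y, x⟩ : ℂ) ^ n = ((-r ^ n : ℝ) : ℂ) := by
  have hnR : (n : ℝ) ≠ 0 := by exact_mod_cast hn
  rw [mem_uniformRing_iff hn hr, mul_div_cancel₀ _ hnR, Complex.exp_pi_mul_I]; simp

theorem sq_add_sq_of_mem_uniformRing {n : ℕ} {r φ x y : ℝ} (h : (x, y) ∈ uniformRing n r φ) :
    r ^ 2 = x ^ 2 + y ^ 2 := by
  obtain ⟨k, -, hk⟩ := h
  obtain ⟨rfl, rfl⟩ := Prod.mk.inj hk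
  linear_combination (-r ^ 2) * Real.sin_sq_add_cos_sq (φ + 2 * Real.pi * k / n)

theorem encard_uniformRing {n : ℕ} (hn : n ≠ 0) {r : ℝ} (hr : 0 < r) (φ : ℝ) :
    (uniformRing n r φ).encard = n := by
  have hnR : (n : ℝ) ≠ 0 := by exact_mod_cast hn
  have himg : uniformRing n r φ = (fun k : ℕ => (r * Real.sin (φ + 2 * Real.pi * k / n),
      r * Real.cos (φ + 2 * Real.pi * k / n))) '' (Finset.range n : Set ℕ) := by
    ext p
    constructor
    · rintro ⟨k, hk, rfl⟩
      exact ⟨k, by simpa using hk, rfl⟩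
    · rintro ⟨k, hk, rfl⟩
      exact ⟨k, by simpa using hk, rfl⟩
  rw [himg, Set.InjOn.encard_image, Set.encard_coe_eq_coe_finsetCard, Finset.card_range]
  intro k hk l hl hkl
  obtain ⟨h1, h2⟩ := Prod.mk.inj hkl
  have h : (r : ℂ) * Complex.exp ((φ + 2 * Real.pi * k / n : ℝ) * Complex.I)
      = r * Complex.exp ((φ + 2 * Real.pi * l / n : ℝ) * Complex.I) := by
    rw [← mk_eq_mul_exp, ← mk_eq_mul_exp, h1, h2]
  have h := mul_left_cancel₀ (Complex.ofReal_ne_zero.2 hr.ne') h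
  rw [Complex.exp_eq_exp_iff_exists_int] at h
  obtain ⟨j, hj⟩ := h
  have hI : (φ + 2 * Real.pi * k / n : ℂ) = φ + 2 * Real.pi * l / n + j * (2 * Real.pi) := by
    apply mul_right_cancel₀ Complex.I_ne_zero
    push_cast at hj
    linear_combination hj
  have hR : (φ + 2 * Real.pi * k / n : ℝ) = φ + 2 * Real.pi * l / n + j * (2 * Real.pi) := by
    exact_mod_cast hI
  have hkl' : (k : ℝ) = l + j * n := by
    field_simp at hR
    apply mul_left_cancel₀ Real.two_pi_pos.ne'
    linear_combination hR
  have hZ : (k : ℤ) = l + j * n := by exact_mod_cast hkl'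
  have hk' : k < n := by simpa using hk
  have hl' : l < n := by simpa using hl
  have : (k : ℤ) % n = l % n := by rw [hZ, Int.add_mul_emod_self_right]
  rw [Int.emod_eq_of_lt (by omega) (by omega), Int.emod_eq_of_lt (by omega) (by omega)] at this
  exact_mod_cast this

/-- The saddle cusps form one ring for each cusp radius: at the angles `2 k π / n` for `σ = κ` and
at the angles `(2 k + 1) π / n` for `σ = -κ`. -/
theorem mem_saddleCusps_iff_mem_uniformRing (m : ℕ) (α β γ : ℝ) (p : ℝ × ℝ) :
    p ∈ saddleCusps (m + 3) α β γ ↔ β ≠ 0 ∧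
      ((∃ r, IsCuspRadius m (defocusRatio α β) (harmonicRatio m β γ) r ∧
        p ∈ uniformRing (m + 3) r 0) ∨
      ∃ r, IsCuspRadius m (defocusRatio α β) (-harmonicRatio m β γ) r ∧
        p ∈ uniformRing (m + 3) r (Real.pi / (m + 3 : ℕ))) := by
  obtain ⟨x, y⟩ := p
  have hn : m + 3 ≠ 0 := by omega
  rw [mem_saddleCusps_iff]
  refine and_congr_right fun _ => ?_
  constructor
  · rintro ⟨ε, r, rfl | rfl, -, hz, hr⟩
    · rw [one_mul] at hz hr
      exact Or.inl ⟨r, hr, (mem_uniformRing_zero_iff hn hr.1 x y).2 hz⟩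
    · rw [neg_one_mul] at hz hr
      exact Or.inr ⟨r, hr, (mem_uniformRing_pi_div_iff hn hr.1 x y).2 hz⟩
  · rintro (⟨r, hr, hp⟩ | ⟨r, hr, hp⟩)
    · refine ⟨1, r, Or.inl rfl, sq_add_sq_of_mem_uniformRing hp, ?_, by rwa [one_mul]⟩
      rw [one_mul]
      exact (mem_uniformRing_zero_iff hn hr.1 x y).1 hp
    · refine ⟨-1, r, Or.inr rfl, sq_add_sq_of_mem_uniformRing hp, ?_, by rwa [neg_one_mul]⟩
      rw [neg_one_mul]
      exact (mem_uniformRing_pi_div_iff hn hr.1 x y).1 hp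

theorem disjoint_uniformRing_zero_pi_div {n : ℕ} (hn : n ≠ 0) {r r' : ℝ} (hr : 0 < r)
    (hr' : 0 < r') : Disjoint (uniformRing n r 0) (uniformRing n r' (Real.pi / n)) := by
  rw [Set.disjoint_left]
  rintro ⟨x, y⟩ h h'
  rw [mem_uniformRing_zero_iff hn hr] at h
  rw [mem_uniformRing_pi_div_iff hn hr', h] at h'
  have : r ^ n = -r' ^ n := by exact_mod_cast h'
  have := pow_pos hr n
  have := pow_pos hr' n
  linarith

theorem mem_uniformRing_self {n : ℕ} (hn : n ≠ 0) (r φ : ℝ) :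
    (r * Real.sin φ, r * Real.cos φ) ∈ uniformRing n r φ :=
  ⟨0, Nat.pos_of_ne_zero hn, by simp⟩

theorem exists_uniformRing_zero_subset_iff (m : ℕ) (α : ℝ) {β : ℝ} (hβ : β ≠ 0) (γ : ℝ) :
    (∃ r, 0 < r ∧ r < 1 ∧ uniformRing (m + 3) r 0 ⊆ saddleCusps (m + 3) α β γ) ↔
      ∃ r, IsCuspRadius m (defocusRatio α β) (harmonicRatio m β γ) r := by
  have hn : m + 3 ≠ 0 := by omega
  constructor
  · rintro ⟨r, hr, -, hsub⟩
    have hp := mem_uniformRing_self hn r 0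
    obtain ⟨-, ⟨r', hr', -⟩ | ⟨r', hr', h'⟩⟩ :=
      (mem_saddleCusps_iff_mem_uniformRing m α β γ _).1 (hsub hp)
    · exact ⟨r', hr'⟩
    · exact absurd h' (Set.disjoint_left.1 (disjoint_uniformRing_zero_pi_div hn hr hr'.1) hp)
  · rintro ⟨r, hr⟩
    exact ⟨r, hr.1, hr.2.1, fun p hp =>
      (mem_saddleCusps_iff_mem_uniformRing m α β γ p).2 ⟨hβ, Or.inl ⟨r, hr, hp⟩⟩⟩

theorem exists_uniformRing_pi_div_subset_iff (m : ℕ) (α : ℝ) {β : ℝ} (hβ : β ≠ 0) (γ : ℝ) :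
    (∃ r, 0 < r ∧ r < 1 ∧
        uniformRing (m + 3) r (Real.pi / (m + 3 : ℕ)) ⊆ saddleCusps (m + 3) α β γ) ↔
      ∃ r, IsCuspRadius m (defocusRatio α β) (-harmonicRatio m β γ) r := by
  have hn : m + 3 ≠ 0 := by omega
  constructor
  · rintro ⟨r, hr, -, hsub⟩
    have hp := mem_uniformRing_self hn r (Real.pi / (m + 3 : ℕ))
    obtain ⟨-, ⟨r', hr', h'⟩ | ⟨r', hr', -⟩⟩ :=
      (mem_saddleCusps_iff_mem_uniformRing m α β γ _).1 (hsub hp)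
    · exact absurd hp (Set.disjoint_left.1 (disjoint_uniformRing_zero_pi_div hn hr'.1 hr) h')
    · exact ⟨r', hr'⟩
  · rintro ⟨r, hr⟩
    exact ⟨r, hr.1, hr.2.1, fun p hp =>
      (mem_saddleCusps_iff_mem_uniformRing m α β γ p).2 ⟨hβ, Or.inr ⟨r, hr, hp⟩⟩⟩

/-- The level functions of `σ` and `-σ` differ by `4 n σ ρ^(n - 2)`. -/
theorem IsCuspRadius.ne_of_neg {m : ℕ} {B σ r s : ℝ} (hr : IsCuspRadius m B σ r)
    (hs : IsCuspRadius m B (-σ) s) : r ≠ s := by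
  rintro rfl
  obtain ⟨h0, -, h1, h2⟩ := hr
  obtain ⟨-, -, h3, -⟩ := hs
  rw [← h3, cuspLevel, cuspLevel] at h1
  have h4 : 4 * ((m : ℝ) + 3) * r ^ (m + 1) * σ = 0 := by linear_combination h1
  have h5 : σ = 0 := (mul_eq_zero.1 h4).resolve_left (by positivity)
  rw [cuspSlope, h5, zero_mul] at h2
  exact lt_irrefl _ h2

/-- If each `σ` has at most one cusp radius, there are no saddle cusps, one ring of them, or two
rings, and the last happens exactly when both `κ` and `-κ` have a cusp radius. -/
theorem saddleCusps_encard_cases (m : ℕ) (α β γ : ℝ)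
    (huniq : ∀ B σ r s, IsCuspRadius m B σ r → IsCuspRadius m B σ s → r = s) :
    ((saddleCusps (m + 3) α β γ).encard = 0 ∧
      ¬(β ≠ 0 ∧ (∃ r, IsCuspRadius m (defocusRatio α β) (harmonicRatio m β γ) r) ∧
        ∃ r, IsCuspRadius m (defocusRatio α β) (-harmonicRatio m β γ) r)) ∨
    ((saddleCusps (m + 3) α β γ).encard = (m + 3 : ℕ) ∧
      (∃ r φ : ℝ, 0 < r ∧ r < 1 ∧ saddleCusps (m + 3) α β γ = uniformRing (m + 3) r φ) ∧
      ¬(β ≠ 0 ∧ (∃ r, IsCuspRadius m (defocusRatio α β) (harmonicRatio m β γ) r) ∧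
        ∃ r, IsCuspRadius m (defocusRatio α β) (-harmonicRatio m β γ) r)) ∨
    ((saddleCusps (m + 3) α β γ).encard = 2 * (m + 3 : ℕ) ∧
      (∃ r₁ r₂ φ₁ φ₂ : ℝ, 0 < r₁ ∧ r₁ < 1 ∧ 0 < r₂ ∧ r₂ < 1 ∧ r₁ ≠ r₂ ∧
        saddleCusps (m + 3) α β γ = uniformRing (m + 3) r₁ φ₁ ∪ uniformRing (m + 3) r₂ φ₂) ∧
      (β ≠ 0 ∧ (∃ r, IsCuspRadius m (defocusRatio α β) (harmonicRatio m β γ) r) ∧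
        ∃ r, IsCuspRadius m (defocusRatio α β) (-harmonicRatio m β γ) r)) := by
  have hn : m + 3 ≠ 0 := by omega
  have hmem := mem_saddleCusps_iff_mem_uniformRing m α β γ
  by_cases hβ : β = 0
  · left
    refine ⟨?_, fun h => h.1 hβ⟩
    rw [Set.encard_eq_zero, Set.eq_empty_iff_forall_notMem]
    exact fun p hp => ((hmem p).1 hp).1 hβ
  simp only [ne_eq, hβ, not_false_eq_true, true_and] at hmem ⊢
  by_cases hE : ∃ r, IsCuspRadius m (defocusRatio α β) (harmonicRatio m β γ) r <;>
    by_cases hO : ∃ r, IsCuspRadius m (defocusRatio α β) (-harmonicRatio m β γ) r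
  · obtain ⟨r, hr⟩ := hE
    obtain ⟨s, hs⟩ := hO
    have heq : saddleCusps (m + 3) α β γ = uniformRing (m + 3) r 0 ∪
        uniformRing (m + 3) s (Real.pi / (m + 3 : ℕ)) := by
      ext p
      rw [hmem, Set.mem_union]
      refine or_congr ⟨?_, fun h => ⟨r, hr, h⟩⟩ ⟨?_, fun h => ⟨s, hs, h⟩⟩
      · rintro ⟨r', hr', h⟩; rwa [huniq _ _ _ _ hr hr']
      · rintro ⟨s', hs', h⟩; rwa [huniq _ _ _ _ hs hs']
    refine Or.inr (Or.inr ⟨?_, ⟨r, s, _, _, hr.1, hr.2.1, hs.1, hs.2.1, hr.ne_of_neg hs, heq⟩,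
      ⟨r, hr⟩, ⟨s, hs⟩⟩)
    rw [heq, Set.encard_union_eq (disjoint_uniformRing_zero_pi_div hn hr.1 hs.1),
      encard_uniformRing hn hr.1, encard_uniformRing hn hs.1, two_mul]
  · obtain ⟨r, hr⟩ := hE
    have heq : saddleCusps (m + 3) α β γ = uniformRing (m + 3) r 0 := by
      ext p
      rw [hmem]
      constructor
      · rintro (⟨r', hr', h⟩ | ⟨s, hs, -⟩)
        · rwa [huniq _ _ _ _ hr hr']
        · exact absurd ⟨s, hs⟩ hO
      · exact fun h => Or.inl ⟨r, hr, h⟩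
    refine Or.inr (Or.inl ⟨?_, ⟨r, _, hr.1, hr.2.1, heq⟩, fun h => hO h.2⟩)
    rw [heq, encard_uniformRing hn hr.1]
  · obtain ⟨r, hr⟩ := hO
    have heq : saddleCusps (m + 3) α β γ =
        uniformRing (m + 3) r (Real.pi / (m + 3 : ℕ)) := by
      ext p
      rw [hmem]
      constructor
      · rintro (⟨s, hs, -⟩ | ⟨r', hr', h⟩)
        · exact absurd ⟨s, hs⟩ hE
        · rwa [huniq _ _ _ _ hr hr']
      · exact fun h => Or.inr ⟨r, hr, h⟩
    refine Or.inr (Or.inl ⟨?_, ⟨r, _, hr.1, hr.2.1, heq⟩, fun h => hE h.1⟩)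
    rw [heq, encard_uniformRing hn hr.1]
  · refine Or.inl ⟨?_, fun h => hE h.1⟩
    rw [Set.encard_eq_zero, Set.eq_empty_iff_forall_notMem]
    intro p hp
    rcases (hmem p).1 hp with ⟨r, hr, -⟩ | ⟨r, hr, -⟩
    · exact hE ⟨r, hr⟩
    · exact hO ⟨r, hr⟩

/-! ### The radii of the rings -/

theorem hasDerivAt_mul_cuspLevel (m : ℕ) (σ : ℝ) {ρ : ℝ} (hρ : 0 < ρ) :
    HasDerivAt (fun t => σ * cuspLevel m σ t) (2 * cuspSlope m σ ρ / ρ) ρ := by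
  have h := ((((hasDerivAt_pow (2 * m) ρ).const_mul ((m + 1) * σ ^ 2)).add
    ((hasDerivAt_pow (m + 1) ρ).const_mul (2 * (m + 3) * σ))).sub
    ((hasDerivAt_pow 2 ρ).const_mul 24)).const_mul σ
  refine h.congr_deriv ?_
  -- for `m = 0`, where the exponent `2 m - 1` is truncated, both sides vanish
  have hm : (m : ℝ) * (ρ ^ (2 * m - 1) * ρ) = m * ρ ^ (2 * m) := by
    rcases m with _ | m
    · simp
    · rw [← pow_succ, show 2 * (m + 1) - 1 + 1 = 2 * (m + 1) by omega]
  rw [eq_div_iff hρ.ne', cuspSlope, Nat.add_sub_cancel]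
  push_cast
  linear_combination (2 * (m + 1) * σ ^ 3) * hm

theorem continuous_mul_cuspLevel (m : ℕ) (σ : ℝ) :
    Continuous (fun t => σ * cuspLevel m σ t) := by
  unfold cuspLevel; fun_prop

theorem strictMonoOn_mul_cuspLevel {m : ℕ} {σ a b : ℝ} (ha : 0 ≤ a)
    (h : ∀ ρ, a < ρ → ρ < b → 0 < cuspSlope m σ ρ) :
    StrictMonoOn (fun t => σ * cuspLevel m σ t) (Set.Icc a b) := by
  refine strictMonoOn_of_deriv_pos (convex_Icc a b) (continuous_mul_cuspLevel m σ).continuousOn ?_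
  intro ρ hρ
  rw [interior_Icc] at hρ
  have hρ0 : 0 < ρ := ha.trans_lt hρ.1
  rw [(hasDerivAt_mul_cuspLevel m σ hρ0).deriv]
  have := h ρ hρ.1 hρ.2
  positivity

theorem antitoneOn_mul_cuspLevel {m : ℕ} {σ a b : ℝ} (ha : 0 ≤ a)
    (h : ∀ ρ, a < ρ → ρ < b → cuspSlope m σ ρ ≤ 0) :
    AntitoneOn (fun t => σ * cuspLevel m σ t) (Set.Icc a b) := by
  have hd : ∀ ρ ∈ interior (Set.Icc a b),
      HasDerivAt (fun t => σ * cuspLevel m σ t) (2 * cuspSlope m σ ρ / ρ) ρ := by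
    intro ρ hρ
    rw [interior_Icc] at hρ
    exact hasDerivAt_mul_cuspLevel m σ (ha.trans_lt hρ.1)
  refine antitoneOn_of_deriv_nonpos (convex_Icc a b) (continuous_mul_cuspLevel m σ).continuousOn
    (fun ρ hρ => (hd ρ hρ).differentiableAt.differentiableWithinAt) ?_
  intro ρ hρ
  rw [(hd ρ hρ).deriv]
  rw [interior_Icc] at hρ
  exact div_nonpos_of_nonpos_of_nonneg (by linarith [h ρ hρ.1 hρ.2]) (ha.trans hρ.1.le)

/-- If the admissible radii form the interval `(a, b)`, then `σ L` increases on it, and it takes the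
value `8 σ B` exactly when this lies between its values at the ends. -/
theorem exists_isCuspRadius_iff {m : ℕ} {σ a b : ℝ} (hσ : σ ≠ 0) (ha : 0 ≤ a) (hab : a < b)
    (hb : b ≤ 1)
    (h : ∀ ρ, 0 < ρ → ρ < 1 → (0 < cuspSlope m σ ρ ↔ a < ρ ∧ ρ < b)) (B : ℝ) :
    (∃ ρ, IsCuspRadius m B σ ρ) ↔
      σ * cuspLevel m σ a < σ * (8 * B) ∧ σ * (8 * B) < σ * cuspLevel m σ b := by
  have hmono : StrictMonoOn (fun t => σ * cuspLevel m σ t) (Set.Icc a b) :=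
    strictMonoOn_mul_cuspLevel ha fun ρ h1 h2 =>
      (h ρ (ha.trans_lt h1) (h2.trans_le hb)).2 ⟨h1, h2⟩
  constructor
  · rintro ⟨ρ, h0, h1, hL, hS⟩
    obtain ⟨h2, h3⟩ := (h ρ h0 h1).1 hS
    rw [← hL]
    exact ⟨hmono (Set.left_mem_Icc.2 hab.le) ⟨h2.le, h3.le⟩ h2,
      hmono ⟨h2.le, h3.le⟩ (Set.right_mem_Icc.2 hab.le) h3⟩
  · intro hB
    obtain ⟨ρ, hρ, hL⟩ := intermediate_value_Ioo hab.le
      (continuous_mul_cuspLevel m σ).continuousOn hB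
    have h0 := ha.trans_lt hρ.1
    have h1 := hρ.2.trans_le hb
    exact ⟨ρ, h0, h1, mul_left_cancel₀ hσ hL, (h ρ h0 h1).2 hρ⟩

theorem not_exists_isCuspRadius {m : ℕ} {σ : ℝ}
    (h : ∀ ρ, 0 < ρ → ρ < 1 → cuspSlope m σ ρ ≤ 0) (B : ℝ) : ¬∃ ρ, IsCuspRadius m B σ ρ := by
  rintro ⟨ρ, h0, h1, -, hS⟩
  exact hS.not_ge (h ρ h0 h1)

/-- If the admissible radii of `σ < 0` form an initial interval `(0, b)`, the level function
decreases on `(0, b)` and increases beyond, so that it takes on `(0, b)` every negative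
value that lies above one of its values. -/
theorem exists_isCuspRadius_of_cuspLevel_lt {m : ℕ} (hm : m ≠ 0) {σ b : ℝ} (hσ : σ < 0)
    (hb0 : 0 < b) (hb : b ≤ 1)
    (h : ∀ ρ, 0 < ρ → ρ < 1 → (0 < cuspSlope m σ ρ ↔ ρ < b)) {B ρ : ℝ} (hB : B < 0)
    (hρ0 : 0 < ρ) (hρ1 : ρ < 1) (hρ : cuspLevel m σ ρ < 8 * B) : ∃ r, IsCuspRadius m B σ r := by
  rw [exists_isCuspRadius_iff hσ.ne le_rfl hb0 hb
    (fun ρ h0 h1 => (h ρ h0 h1).trans (and_iff_right h0).symm)]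
  have h0 : cuspLevel m σ 0 = 0 := by simp [cuspLevel, hm]
  have hmin : σ * cuspLevel m σ ρ ≤ σ * cuspLevel m σ b := by
    rcases le_total ρ b with hle | hle
    · exact (strictMonoOn_mul_cuspLevel le_rfl fun t ht0 htb =>
        (h t ht0 (htb.trans_le hb)).2 htb).monotoneOn ⟨hρ0.le, hle⟩ ⟨hb0.le, le_rfl⟩ hle
    · exact antitoneOn_mul_cuspLevel hb0.le (fun t ht ht1 =>
        not_lt.1 fun hc => ((h t (hb0.trans ht) ht1).1 hc).not_gt ht)
        ⟨le_rfl, hb⟩ ⟨hle, hρ1.le⟩ hle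
  rw [h0]
  constructor
  · rw [mul_lt_mul_left_of_neg hσ]; linarith
  · exact lt_of_lt_of_le ((mul_lt_mul_left_of_neg hσ).2 hρ) hmin

/-- Two cusp radii would enclose an interval on which `σ L` increases strictly, although it takes
the same value at both ends. -/
theorem IsCuspRadius.unique_of_ordConnected {m : ℕ} {B σ : ℝ}
    (hconn : ∀ r s ρ, 0 < r → r < ρ → ρ < s → 0 < cuspSlope m σ r → 0 < cuspSlope m σ s →
      0 < cuspSlope m σ ρ) {r s : ℝ}
    (hr : IsCuspRadius m B σ r) (hs : IsCuspRadius m B σ s) : r = s := by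
  have key : ∀ {r s : ℝ}, IsCuspRadius m B σ r → IsCuspRadius m B σ s → ¬r < s := by
    rintro r s ⟨hr0, -, hr, hr'⟩ ⟨-, -, hs, hs'⟩ hrs
    have := strictMonoOn_mul_cuspLevel hr0.le
      (fun ρ h1 h2 => hconn r s ρ hr0 h1 h2 hr' hs')
      (Set.left_mem_Icc.2 hrs.le) (Set.right_mem_Icc.2 hrs.le) hrs
    simp only [hr, hs, lt_self_iff_false] at this
  exact le_antisymm (not_lt.1 (key hs hr)) (not_lt.1 (key hr hs))

theorem cuspLevel_zero_eq (σ ρ : ℝ) : cuspLevel 0 σ ρ = σ ^ 2 + 6 * σ * ρ - 24 * ρ ^ 2 := by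
  unfold cuspLevel; push_cast; ring

theorem cuspLevel_one_eq (σ ρ : ℝ) :
    cuspLevel 1 σ ρ = 2 * ρ ^ 2 * ((σ + 6) * (σ - 2)) := by
  unfold cuspLevel; push_cast; ring

theorem cuspLevel_two_eq (σ ρ : ℝ) :
    cuspLevel 2 σ ρ = 3 * σ ^ 2 * ρ ^ 4 + 10 * σ * ρ ^ 3 - 24 * ρ ^ 2 := by
  unfold cuspLevel; push_cast; ring

theorem cuspLevel_three_eq (σ ρ : ℝ) :
    cuspLevel 3 σ ρ = 4 * σ ^ 2 * ρ ^ 6 + 12 * σ * ρ ^ 4 - 24 * ρ ^ 2 := by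
  unfold cuspLevel; push_cast; ring

theorem cuspSlope_zero_eq (σ ρ : ℝ) : cuspSlope 0 σ ρ = 3 * ρ * (σ * (σ - 8 * ρ)) := by
  unfold cuspSlope; push_cast; ring

theorem cuspSlope_one_eq (σ ρ : ℝ) :
    cuspSlope 1 σ ρ = 2 * ρ ^ 2 * (σ * ((σ + 6) * (σ - 2))) := by
  unfold cuspSlope; push_cast; ring

theorem cuspSlope_two_eq (σ ρ : ℝ) :
    cuspSlope 2 σ ρ =
      6 * ρ ^ 2 * (σ * ((σ * ρ + (√89 + 5) / 4) * (σ * ρ - (√89 - 5) / 4))) := by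
  have h : √89 ^ 2 = 89 := Real.sq_sqrt (by norm_num)
  unfold cuspSlope; push_cast
  linear_combination (-3 / 8 * ρ ^ 2 * σ) * (-h)

theorem cuspSlope_three_eq (σ ρ : ℝ) :
    cuspSlope 3 σ ρ =
      12 * ρ ^ 2 * (σ * ((σ * ρ ^ 2 + (√3 + 1)) * (σ * ρ ^ 2 - (√3 - 1)))) := by
  have h : √3 ^ 2 = 3 := Real.sq_sqrt (by norm_num)
  unfold cuspSlope; push_cast
  linear_combination (-12 * ρ ^ 2 * σ) * (-h)

theorem five_lt_sqrt_eightyNine : 5 < √89 := by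
  rw [Real.lt_sqrt (by norm_num)]; norm_num

theorem one_lt_sqrt_three : 1 < √3 := by
  rw [Real.lt_sqrt (by norm_num)]; norm_num

theorem mul_mul_sub_pos_iff_of_pos {c w u v : ℝ} (hc : 0 < c) (hu : 0 < u) (hw : 0 < w) :
    0 < c * ((w + u) * (w - v)) ↔ v < w := by
  rw [mul_pos_iff_of_pos_left hc, mul_pos_iff_of_pos_left (by positivity), sub_pos]

theorem mul_mul_sub_pos_iff_of_neg {c w u v : ℝ} (hc : c < 0) (hv : 0 < v) (hw : w < 0) :
    0 < c * ((w + u) * (w - v)) ↔ -w < u := by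
  rw [mul_comm (w + u), ← mul_assoc,
    mul_pos_iff_of_pos_left (mul_pos_of_neg_of_neg hc (by linarith))]
  constructor <;> intro h <;> linarith

theorem cuspSlope_two_pos_iff_of_pos {σ ρ : ℝ} (hσ : 0 < σ) (hρ : 0 < ρ) :
    0 < cuspSlope 2 σ ρ ↔ (√89 - 5) / 4 / σ < ρ := by
  have := five_lt_sqrt_eightyNine
  rw [cuspSlope_two_eq, mul_pos_iff_of_pos_left (by positivity),
    mul_mul_sub_pos_iff_of_pos hσ (by linarith) (by positivity), div_lt_iff₀ hσ, mul_comm ρ]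

theorem cuspSlope_two_pos_iff_of_neg {σ ρ : ℝ} (hσ : σ < 0) (hρ : 0 < ρ) :
    0 < cuspSlope 2 σ ρ ↔ ρ < (√89 + 5) / 4 / (-σ) := by
  have := five_lt_sqrt_eightyNine
  rw [cuspSlope_two_eq, mul_pos_iff_of_pos_left (by positivity),
    mul_mul_sub_pos_iff_of_neg hσ (by linarith) (mul_neg_of_neg_of_pos hσ hρ),
    lt_div_iff₀ (neg_pos.2 hσ), ← neg_mul, mul_comm ρ]

theorem cuspSlope_three_pos_iff_of_pos {σ ρ : ℝ} (hσ : 0 < σ) (hρ : 0 < ρ) :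
    0 < cuspSlope 3 σ ρ ↔ √((√3 - 1) / σ) < ρ := by
  have := one_lt_sqrt_three
  rw [cuspSlope_three_eq, mul_pos_iff_of_pos_left (by positivity),
    mul_mul_sub_pos_iff_of_pos hσ (by linarith) (by positivity), Real.sqrt_lt' hρ,
    div_lt_iff₀ hσ, mul_comm σ]

theorem cuspSlope_three_pos_iff_of_neg {σ ρ : ℝ} (hσ : σ < 0) (hρ : 0 < ρ) :
    0 < cuspSlope 3 σ ρ ↔ ρ < √((√3 + 1) / (-σ)) := by
  have := one_lt_sqrt_three
  rw [cuspSlope_three_eq, mul_pos_iff_of_pos_left (by positivity),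
    mul_mul_sub_pos_iff_of_neg hσ (by linarith) (mul_neg_of_neg_of_pos hσ (by positivity)),
    Real.lt_sqrt hρ.le, lt_div_iff₀ (neg_pos.2 hσ), ← neg_mul, mul_comm (ρ ^ 2)]

theorem ne_zero_of_cuspSlope_pos {m : ℕ} {σ ρ : ℝ} (h : 0 < cuspSlope m σ ρ) : σ ≠ 0 := by
  rintro rfl
  rw [cuspSlope, zero_mul] at h
  exact lt_irrefl _ h

theorem IsCuspRadius.unique {m : ℕ} (hm : m ≤ 3) {B σ r s : ℝ}
    (hr : IsCuspRadius m B σ r) (hs : IsCuspRadius m B σ s) : r = s := by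
  refine IsCuspRadius.unique_of_ordConnected ?_ hr hs
  intro r s ρ h0 h1 h2 hr hs
  have hρ : 0 < ρ := h0.trans h1
  have hs0 : 0 < s := hρ.trans h2
  have hσ := ne_zero_of_cuspSlope_pos hr
  interval_cases m
  · rw [cuspSlope_zero_eq, mul_pos_iff_of_pos_left (by positivity)] at *
    rcases lt_or_gt_of_ne hσ with h | h <;> nlinarith
  · rw [cuspSlope_one_eq, mul_pos_iff_of_pos_left (by positivity)] at *
    exact hr
  · rcases lt_or_gt_of_ne hσ with h | h
    · rw [cuspSlope_two_pos_iff_of_neg h hs0] at hs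
      exact (cuspSlope_two_pos_iff_of_neg h hρ).2 (h2.trans hs)
    · rw [cuspSlope_two_pos_iff_of_pos h h0] at hr
      exact (cuspSlope_two_pos_iff_of_pos h hρ).2 (hr.trans h1)
  · rcases lt_or_gt_of_ne hσ with h | h
    · rw [cuspSlope_three_pos_iff_of_neg h hs0] at hs
      exact (cuspSlope_three_pos_iff_of_neg h hρ).2 (h2.trans hs)
    · rw [cuspSlope_three_pos_iff_of_pos h h0] at hr
      exact (cuspSlope_three_pos_iff_of_pos h hρ).2 (hr.trans h1)

/-- For `n = 3` the slope is `3 ρ σ (σ - 8 ρ)`. The bound `11 / 8 σ²` is the maximum of the level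
function of `σ > 0`, at `ρ = σ / 8`, and `σ²` is its value at `0`. -/
theorem exists_isCuspRadius_zero_iff (B σ : ℝ) : (∃ ρ, IsCuspRadius 0 B σ ρ) ↔
    (σ < 0 ∧ cuspLevel 0 σ 1 < 8 * B ∧ 8 * B < σ ^ 2) ∨
    (0 < σ ∧ σ ≤ 8 ∧ σ ^ 2 < 8 * B ∧ 8 * B < 11 / 8 * σ ^ 2) ∨
    (8 < σ ∧ σ ^ 2 < 8 * B ∧ 8 * B < cuspLevel 0 σ 1) := by
  have hL0 : cuspLevel 0 σ 0 = σ ^ 2 := by rw [cuspLevel_zero_eq]; ring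
  rcases lt_trichotomy σ 0 with h | rfl | h
  · rw [exists_isCuspRadius_iff h.ne le_rfl one_pos le_rfl, hL0, mul_lt_mul_left_of_neg h,
      mul_lt_mul_left_of_neg h]
    · constructor
      · exact fun H => Or.inl ⟨h, H.2, H.1⟩
      · rintro (H | H | H)
        · exact ⟨H.2.2, H.2.1⟩
        · linarith
        · linarith
    · intro ρ h0 h1
      rw [cuspSlope_zero_eq, mul_pos_iff_of_pos_left (by positivity)]
      exact iff_of_true (mul_pos_of_neg_of_neg h (by linarith)) ⟨h0, h1⟩
  · refine iff_of_false (not_exists_isCuspRadius (by simp [cuspSlope]) B) ?_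
    rintro (H | H | H) <;> linarith [H.1]
  · have hS : ∀ ρ, 0 < ρ → (0 < cuspSlope 0 σ ρ ↔ ρ < σ / 8) := by
      intro ρ h0
      rw [cuspSlope_zero_eq, mul_pos_iff_of_pos_left (by positivity), mul_pos_iff_of_pos_left h,
        lt_div_iff₀ (by norm_num), sub_pos, mul_comm]
    rcases le_or_gt σ 8 with h8 | h8
    · rw [exists_isCuspRadius_iff h.ne' le_rfl (b := σ / 8) (by positivity) (by linarith), hL0,
        mul_lt_mul_iff_right₀ h, mul_lt_mul_iff_right₀ h, cuspLevel_zero_eq σ (σ / 8),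
        show σ ^ 2 + 6 * σ * (σ / 8) - 24 * (σ / 8) ^ 2 = 11 / 8 * σ ^ 2 by ring]
      · constructor
        · exact fun H => Or.inr (Or.inl ⟨h, h8, H⟩)
        · rintro (H | H | H)
          · linarith
          · exact H.2.2
          · linarith
      · intro ρ h0 h1
        rw [hS ρ h0, and_iff_right h0]
    · rw [exists_isCuspRadius_iff h.ne' le_rfl one_pos le_rfl, hL0,
        mul_lt_mul_iff_right₀ h, mul_lt_mul_iff_right₀ h]
      · constructor
        · exact fun H => Or.inr (Or.inr ⟨h8, H⟩)
        · rintro (H | H | H)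
          · linarith
          · linarith
          · exact H.2
      · intro ρ h0 h1
        rw [hS ρ h0]
        exact iff_of_true (by linarith) ⟨h0, h1⟩

/-- For `n = 4` the sign of the slope does not depend on `ρ`. -/
theorem exists_isCuspRadius_one_iff (B σ : ℝ) : (∃ ρ, IsCuspRadius 1 B σ ρ) ↔
    (-6 < σ ∧ σ < 0 ∧ cuspLevel 1 σ 1 < 8 * B ∧ 8 * B < 0) ∨
    (2 < σ ∧ 0 < 8 * B ∧ 8 * B < cuspLevel 1 σ 1) := by
  have hL0 : cuspLevel 1 σ 0 = 0 := by rw [cuspLevel_one_eq]; ring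
  have hS : ∀ ρ, 0 < ρ → (0 < cuspSlope 1 σ ρ ↔ 0 < σ * ((σ + 6) * (σ - 2))) := fun ρ h0 => by
    rw [cuspSlope_one_eq, mul_pos_iff_of_pos_left (by positivity)]
  by_cases h1 : -6 < σ ∧ σ < 0
  · have hpos : 0 < σ * ((σ + 6) * (σ - 2)) := mul_pos_of_neg_of_neg h1.2
      (mul_neg_of_pos_of_neg (by linarith) (by linarith))
    rw [exists_isCuspRadius_iff h1.2.ne le_rfl one_pos le_rfl
      fun ρ h0 h1 => iff_of_true ((hS ρ h0).2 hpos) ⟨h0, h1⟩, hL0, mul_lt_mul_left_of_neg h1.2,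
      mul_lt_mul_left_of_neg h1.2]
    constructor
    · exact fun H => Or.inl ⟨h1.1, h1.2, H.2, H.1⟩
    · rintro (H | H)
      · exact ⟨H.2.2.2, H.2.2.1⟩
      · linarith
  by_cases h2 : 2 < σ
  · have h : 0 < σ := by linarith
    have hpos : 0 < σ * ((σ + 6) * (σ - 2)) :=
      mul_pos h (mul_pos (by linarith) (by linarith))
    rw [exists_isCuspRadius_iff h.ne' le_rfl one_pos le_rfl
      fun ρ h0 h1 => iff_of_true ((hS ρ h0).2 hpos) ⟨h0, h1⟩, hL0, mul_lt_mul_iff_right₀ h,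
      mul_lt_mul_iff_right₀ h]
    constructor
    · exact fun H => Or.inr ⟨h2, H⟩
    · rintro (H | H)
      · linarith
      · exact H.2
  · refine iff_of_false (not_exists_isCuspRadius (fun ρ h0 _ => ?_) B) ?_
    · rw [← not_lt, hS ρ h0, not_lt]
      rcases le_or_gt 0 σ with h | h
      · exact mul_nonpos_of_nonneg_of_nonpos h
          (mul_nonpos_of_nonneg_of_nonpos (by linarith) (by linarith))
      · have : σ ≤ -6 := not_lt.1 fun H => h1 ⟨H, h⟩
        exact mul_nonpos_of_nonpos_of_nonneg h.le
          (mul_nonneg_of_nonpos_of_nonpos (by linarith) (by linarith))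
    · rintro (H | H)
      · exact h1 ⟨H.1, H.2.1⟩
      · exact h2 H.1

/-- The common form of the cases `n = 5, 6`: for `σ > 0` the admissible radii are those beyond
`a σ`, which is inside the pupil for `σ > v`, and for `σ < 0` those below `b σ`, which is inside the
pupil for `σ ≤ -u`. -/
theorem exists_isCuspRadius_iff_of_thresholds {m : ℕ} (hm : m ≠ 0) {a b : ℝ → ℝ} {u v : ℝ}
    (hu : 0 < u) (hv : 0 < v) (ha : ∀ σ, 0 < σ → 0 < a σ ∧ (a σ < 1 ↔ v < σ))
    (hb : ∀ σ, σ < 0 → 0 < b σ ∧ (b σ ≤ 1 ↔ σ ≤ -u))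
    (hpos : ∀ σ ρ, 0 < σ → 0 < ρ → (0 < cuspSlope m σ ρ ↔ a σ < ρ))
    (hneg : ∀ σ ρ, σ < 0 → 0 < ρ → (0 < cuspSlope m σ ρ ↔ ρ < b σ)) (B σ : ℝ) :
    (∃ ρ, IsCuspRadius m B σ ρ) ↔
      (σ ≤ -u ∧ cuspLevel m σ (b σ) < 8 * B ∧ 8 * B < 0) ∨
      (-u < σ ∧ σ < 0 ∧ cuspLevel m σ 1 < 8 * B ∧ 8 * B < 0) ∨
      (v < σ ∧ cuspLevel m σ (a σ) < 8 * B ∧ 8 * B < cuspLevel m σ 1) := by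
  have hL0 : cuspLevel m σ 0 = 0 := by simp [cuspLevel, hm]
  rcases lt_trichotomy σ 0 with h | rfl | h
  · obtain ⟨hb0, hb1⟩ := hb σ h
    rcases le_or_gt σ (-u) with h1 | h1
    · rw [exists_isCuspRadius_iff h.ne le_rfl hb0 (hb1.2 h1)
        (fun ρ h0 _ => by rw [hneg σ ρ h h0, and_iff_right h0]), hL0,
        mul_lt_mul_left_of_neg h, mul_lt_mul_left_of_neg h]
      constructor
      · exact fun H => Or.inl ⟨h1, H.2, H.1⟩
      · rintro (H | H | H)
        · exact ⟨H.2.2, H.2.1⟩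
        · linarith
        · linarith
    · have hb2 : 1 < b σ := not_le.1 fun H => h1.not_ge (hb1.1 H)
      rw [exists_isCuspRadius_iff h.ne le_rfl one_pos le_rfl
        (fun ρ h0 h2 => iff_of_true ((hneg σ ρ h h0).2 (h2.trans hb2)) ⟨h0, h2⟩), hL0,
        mul_lt_mul_left_of_neg h, mul_lt_mul_left_of_neg h]
      constructor
      · exact fun H => Or.inr (Or.inl ⟨h1, h, H.2, H.1⟩)
      · rintro (H | H | H)
        · linarith
        · exact ⟨H.2.2.2, H.2.2.1⟩
        · linarith
  · refine iff_of_false (not_exists_isCuspRadius (by simp [cuspSlope]) B) ?_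
    rintro (H | H | H)
    · linarith [H.1]
    · exact lt_irrefl _ H.2.1
    · linarith [H.1]
  · obtain ⟨ha0, ha1⟩ := ha σ h
    rcases le_or_gt σ v with h1 | h1
    · have ha2 : 1 ≤ a σ := not_lt.1 fun H => h1.not_gt (ha1.1 H)
      refine iff_of_false (not_exists_isCuspRadius (fun ρ h0 h2 => ?_) B) ?_
      · rw [← not_lt, hpos σ ρ h h0]
        linarith
      · rintro (H | H | H) <;> linarith [H.1]
    · rw [exists_isCuspRadius_iff h.ne' ha0.le (ha1.2 h1) le_rfl
        (fun ρ h0 h2 => by rw [hpos σ ρ h h0, and_iff_left h2]),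
        mul_lt_mul_iff_right₀ h, mul_lt_mul_iff_right₀ h]
      constructor
      · exact fun H => Or.inr (Or.inr ⟨h1, H⟩)
      · rintro (H | H | H)
        · linarith
        · linarith
        · exact H.2

/-- For `n = 5` the thresholds are the zeros `(-5 ± √89) / 4` of the slope in the variable
`w = σ ρ`, and the constants over `32 σ²` come from the value of the level function there. -/
theorem exists_isCuspRadius_two_iff (B σ : ℝ) : (∃ ρ, IsCuspRadius 2 B σ ρ) ↔
    (σ ≤ -((√89 + 5) / 4) ∧ -((4561 + 445 * √89) / (32 * σ ^ 2)) < 8 * B ∧ 8 * B < 0) ∨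
    (-((√89 + 5) / 4) < σ ∧ σ < 0 ∧ cuspLevel 2 σ 1 < 8 * B ∧ 8 * B < 0) ∨
    ((√89 - 5) / 4 < σ ∧ -((4561 - 445 * √89) / (32 * σ ^ 2)) < 8 * B ∧
      8 * B < cuspLevel 2 σ 1) := by
  have h5 := five_lt_sqrt_eightyNine
  have hsq : √89 ^ 2 = 89 := Real.sq_sqrt (by norm_num)
  have hu : 0 < (√89 + 5) / 4 := by linarith
  have hv : 0 < (√89 - 5) / 4 := by linarith
  rw [exists_isCuspRadius_iff_of_thresholds two_ne_zero hu hv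
    (a := fun σ => (√89 - 5) / 4 / σ) (b := fun σ => (√89 + 5) / 4 / (-σ))
    (fun σ h => ⟨by positivity, div_lt_one h⟩)
    (fun σ h => ⟨div_pos hu (neg_pos.2 h), by rw [div_le_one (neg_pos.2 h), le_neg]⟩)
    (fun σ ρ => cuspSlope_two_pos_iff_of_pos) (fun σ ρ => cuspSlope_two_pos_iff_of_neg)]
  refine or_congr (and_congr_right fun h => ?_) (or_congr_right (and_congr_right fun h => ?_))
  · have hσ : σ ≠ 0 := by rintro rfl; linarith
    have : cuspLevel 2 σ ((√89 + 5) / 4 / (-σ)) = -((4561 + 445 * √89) / (32 * σ ^ 2)) := by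
      rw [cuspLevel_two_eq]
      field_simp
      linear_combination 32 * (3 * √89 ^ 2 + 20 * √89 - 267) * hsq
    rw [this]
  · have hσ : σ ≠ 0 := by rintro rfl; linarith
    have : cuspLevel 2 σ ((√89 - 5) / 4 / σ) = -((4561 - 445 * √89) / (32 * σ ^ 2)) := by
      rw [cuspLevel_two_eq]
      field_simp
      linear_combination 32 * (3 * √89 ^ 2 - 20 * √89 - 267) * hsq
    rw [this]

/-- For `n = 6` the thresholds are the zeros `-1 ± √3` of the slope in the variable `w = σ ρ²`,
and the constants over `σ` come from the value of the level function there. -/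
theorem exists_isCuspRadius_three_iff (B σ : ℝ) : (∃ ρ, IsCuspRadius 3 B σ ρ) ↔
    (σ ≤ -(√3 + 1) ∧ (24 * √3 + 32) / σ < 8 * B ∧ 8 * B < 0) ∨
    (-(√3 + 1) < σ ∧ σ < 0 ∧ cuspLevel 3 σ 1 < 8 * B ∧ 8 * B < 0) ∨
    (√3 - 1 < σ ∧ -((24 * √3 - 32) / σ) < 8 * B ∧ 8 * B < cuspLevel 3 σ 1) := by
  have h1 := one_lt_sqrt_three
  have hsq : √3 ^ 2 = 3 := Real.sq_sqrt (by norm_num)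
  have hu : 0 < √3 + 1 := by linarith
  have hv : 0 < √3 - 1 := by linarith
  rw [exists_isCuspRadius_iff_of_thresholds three_ne_zero hu hv
    (a := fun σ => √((√3 - 1) / σ)) (b := fun σ => √((√3 + 1) / (-σ)))
    (fun σ h => ⟨by positivity, by rw [Real.sqrt_lt' one_pos, one_pow, div_lt_one h]⟩)
    (fun σ h => ⟨Real.sqrt_pos.2 (div_pos hu (neg_pos.2 h)), by
      rw [Real.sqrt_le_iff, one_pow, and_iff_right zero_le_one, div_le_one (neg_pos.2 h), le_neg]⟩)
    (fun σ ρ => cuspSlope_three_pos_iff_of_pos) (fun σ ρ => cuspSlope_three_pos_iff_of_neg)]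
  refine or_congr (and_congr_right fun h => ?_) (or_congr_right (and_congr_right fun h => ?_))
  · have hσ : σ < 0 := by linarith
    have hr : √((√3 + 1) / (-σ)) ^ 2 = (√3 + 1) / (-σ) :=
      Real.sq_sqrt (div_pos hu (neg_pos.2 hσ)).le
    have : cuspLevel 3 σ √((√3 + 1) / (-σ)) = (24 * √3 + 32) / σ := by
      rw [cuspLevel_three_eq, show ∀ t : ℝ, t ^ 6 = (t ^ 2) ^ 3 by intro t; ring,
        show ∀ t : ℝ, t ^ 4 = (t ^ 2) ^ 2 by intro t; ring, hr]
      have := hσ.ne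
      field_simp
      linear_combination -4 * √3 * hsq
    rw [this]
  · have hσ : 0 < σ := by linarith
    have hr : √((√3 - 1) / σ) ^ 2 = (√3 - 1) / σ := Real.sq_sqrt (div_pos hv hσ).le
    have : cuspLevel 3 σ √((√3 - 1) / σ) = -((24 * √3 - 32) / σ) := by
      rw [cuspLevel_three_eq, show ∀ t : ℝ, t ^ 6 = (t ^ 2) ^ 3 by intro t; ring,
        show ∀ t : ℝ, t ^ 4 = (t ^ 2) ^ 2 by intro t; ring, hr]
      field_simp
      linear_combination 4 * √3 * hsq
    rw [this]

/-! ### The regions in the parameters of the wave aberration -/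

theorem eq_of_defocusRatio {α β B : ℝ} (hβ : β ≠ 0) (hB : defocusRatio α β = B) :
    α = √15 * β * (1 + B) := by
  have h3 : √3 ^ 2 = 3 := Real.sq_sqrt (by norm_num)
  have h5 : √5 ≠ 0 := by positivity
  have h15 : √15 = √3 * √5 := by rw [← Real.sqrt_mul (by norm_num)]; norm_num
  rw [← hB, defocusRatio, h15]
  field_simp
  linear_combination (-2 * α) * h3

/-- The parameter `γ` in terms of `κ`; the factor `q` is the inverse of
`√(2 (n + 1)) n (n - 1) / (12 √5)` for `n = m + 3`. -/
theorem eq_of_harmonicRatio {m : ℕ} {β γ κ q : ℝ} (hβ : β ≠ 0) (hκ : harmonicRatio m β γ = κ)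
    (hq : √(2 * ((m + 3 : ℕ) + 1)) * (m + 3) * (m + 2) * q = 12 * √5) : γ = κ * q * β := by
  have h5 : √5 ≠ 0 := by positivity
  rw [← hκ, harmonicRatio]
  field_simp
  linear_combination -γ * hq

theorem sqrt_mul_sqrt_eq {a b c : ℝ} (ha : 0 ≤ a) (hc : 0 ≤ c) (h : a * b = c ^ 2 * 5) :
    √a * √b = c * √5 := by
  rw [← Real.sqrt_mul ha, h, Real.sqrt_mul (by positivity), Real.sqrt_sq hc]

theorem eq_of_harmonicRatio_zero {β γ κ : ℝ} (hβ : β ≠ 0) (hκ : harmonicRatio 0 β γ = κ) :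
    γ = κ * (√10 / 2) * β := by
  refine eq_of_harmonicRatio hβ hκ ?_
  have : √8 * √10 = 4 * √5 := sqrt_mul_sqrt_eq (by norm_num) (by norm_num) (by norm_num)
  norm_num
  linear_combination 3 * this

theorem eq_of_harmonicRatio_one {β γ κ : ℝ} (hβ : β ≠ 0) (hκ : harmonicRatio 1 β γ = κ) :
    γ = κ * (√2 / 2) * β := by
  refine eq_of_harmonicRatio hβ hκ ?_
  have : √10 * √2 = 2 * √5 := sqrt_mul_sqrt_eq (by norm_num) (by norm_num) (by norm_num)
  norm_num
  linear_combination 6 * this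

theorem eq_of_harmonicRatio_two {β γ κ : ℝ} (hβ : β ≠ 0) (hκ : harmonicRatio 2 β γ = κ) :
    γ = κ * (√15 / 10) * β := by
  refine eq_of_harmonicRatio hβ hκ ?_
  have : √12 * √15 = 6 * √5 := sqrt_mul_sqrt_eq (by norm_num) (by norm_num) (by norm_num)
  norm_num
  linear_combination 2 * this

theorem eq_of_harmonicRatio_three {β γ κ : ℝ} (hβ : β ≠ 0) (hκ : harmonicRatio 3 β γ = κ) :
    γ = κ * (√70 / 35) * β := by
  refine eq_of_harmonicRatio hβ hκ ?_
  have : √14 * √70 = 14 * √5 := sqrt_mul_sqrt_eq (by norm_num) (by norm_num) (by norm_num)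
  norm_num
  linear_combination 30 / 35 * this

theorem mul_one_add_lt_mul_one_add_iff {c x y : ℝ} (hc : 0 < c) :
    c * (1 + x / 8) < c * (1 + y / 8) ↔ x < y := by
  rw [mul_lt_mul_iff_right₀ hc]
  constructor <;> intro h <;> linarith

theorem mul_mul_lt_mul_mul_iff {x y q β : ℝ} (hq : 0 < q) (hβ : 0 < β) :
    x * q * β < y * q * β ↔ x < y := by
  rw [mul_lt_mul_iff_left₀ hβ, mul_lt_mul_iff_left₀ hq]

theorem mul_mul_le_mul_mul_iff {x y q β : ℝ} (hq : 0 < q) (hβ : 0 < β) :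
    x * q * β ≤ y * q * β ↔ x ≤ y := by
  rw [mul_le_mul_iff_left₀ hβ, mul_le_mul_iff_left₀ hq]

theorem mul_mul_neg_iff {x q β : ℝ} (hq : 0 < q) (hβ : 0 < β) : x * q * β < 0 ↔ x < 0 := by
  simpa using mul_mul_lt_mul_mul_iff (x := x) (y := 0) hq hβ

theorem mul_mul_pos_iff {x q β : ℝ} (hq : 0 < q) (hβ : 0 < β) : 0 < x * q * β ↔ 0 < x := by
  simpa using mul_mul_lt_mul_mul_iff (x := 0) (y := x) hq hβ

theorem mul_one_add_lt_self_iff {c x : ℝ} (hc : 0 < c) : c * (1 + x / 8) < c ↔ x < 0 := by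
  simpa using mul_one_add_lt_mul_one_add_iff (x := x) (y := 0) hc

theorem lt_mul_one_add_self_iff {c x : ℝ} (hc : 0 < c) : c < c * (1 + x / 8) ↔ 0 < x := by
  simpa using mul_one_add_lt_mul_one_add_iff (x := 0) (y := x) hc

theorem evenRegion_three_iff (α : ℝ) {β : ℝ} (hβ : 0 < β) (γ : ℝ) :
    evenRegion 3 α β γ ↔
      ∃ ρ, IsCuspRadius 0 (defocusRatio α β) (harmonicRatio 0 β γ) ρ := by
  rw [exists_isCuspRadius_zero_iff]
  have hα := eq_of_defocusRatio (α := α) hβ.ne' rfl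
  have hγ := eq_of_harmonicRatio_zero (γ := γ) hβ.ne' rfl
  generalize defocusRatio α β = B at *
  generalize harmonicRatio 0 β γ = κ at *
  have h15 : √15 ^ 2 = 15 := Real.sq_sqrt (by norm_num)
  have h10 : √10 ^ 2 = 10 := Real.sq_sqrt (by norm_num)
  have hq : 0 < √10 / 2 := by positivity
  have hc : 0 < √15 * β := by positivity
  have e8 : 4 * √10 * β = 8 * (√10 / 2) * β := by ring
  have eα : α = √15 * β * (1 + 8 * B / 8) := by rw [hα]; ring
  have e1 : alphaOne 3 1 β γ = √15 * β * (1 + cuspLevel 0 κ 1 / 8) := by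
    rw [alphaOne, cuspLevel_zero_eq, hγ]
    field_simp
    linear_combination (24 * κ ^ 2 + 144 * κ) * h10 - (16 * κ ^ 2 + 96 * κ - 256) * h15
  have e2 : alphaTwo3 β γ = √15 * β * (1 + κ ^ 2 / 8) := by
    rw [alphaTwo3, hγ]
    field_simp
    linear_combination 24 * κ ^ 2 * h10 - (16 * κ ^ 2 + 128) * h15
  have e3 : alphaThree3 β γ = √15 * β * (1 + 11 / 8 * κ ^ 2 / 8) := by
    rw [alphaThree3, hγ]
    field_simp
    linear_combination 2112 * κ ^ 2 * h10 - (1408 * κ ^ 2 + 8192) * h15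
  have hL := @mul_one_add_lt_mul_one_add_iff (√15 * β)
  have hG := fun x y => @mul_mul_lt_mul_mul_iff x y (√10 / 2) β hq hβ
  have g1 : γ < 0 ↔ κ < 0 := by rw [hγ, mul_mul_neg_iff hq hβ]
  have g2 : 0 < γ ↔ 0 < κ := by rw [hγ, mul_mul_pos_iff hq hβ]
  have g3 : γ ≤ 4 * √10 * β ↔ κ ≤ 8 := by rw [hγ, e8, mul_mul_le_mul_mul_iff hq hβ]
  have g4 : 4 * √10 * β < γ ↔ 8 < κ := by rw [hγ, e8, hG]
  simp only [evenRegion, g1, g2, g3, g4]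
  rw [e1, e2, e3, eα]
  simp only [hL hc]

theorem evenRegion_four_iff (α : ℝ) {β : ℝ} (hβ : 0 < β) (γ : ℝ) :
    evenRegion 4 α β γ ↔
      ∃ ρ, IsCuspRadius 1 (defocusRatio α β) (harmonicRatio 1 β γ) ρ := by
  rw [exists_isCuspRadius_one_iff]
  have hα := eq_of_defocusRatio (α := α) hβ.ne' rfl
  have hγ := eq_of_harmonicRatio_one (γ := γ) hβ.ne' rfl
  generalize defocusRatio α β = B at *
  generalize harmonicRatio 1 β γ = κ at *
  have h15 : √15 ^ 2 = 15 := Real.sq_sqrt (by norm_num)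
  have h2 : √2 ^ 2 = 2 := Real.sq_sqrt (by norm_num)
  have hq : 0 < √2 / 2 := by positivity
  have hc : 0 < √15 * β := by positivity
  have e6 : -(3 * √2 * β) = (-6) * (√2 / 2) * β := by ring
  have e2 : √2 * β = 2 * (√2 / 2) * β := by ring
  have eα : α = √15 * β * (1 + 8 * B / 8) := by rw [hα]; ring
  have e1 : alphaOne 4 1 β γ = √15 * β * (1 + cuspLevel 1 κ 1 / 8) := by
    rw [alphaOne, cuspLevel_one_eq, hγ]
    field_simp
    linear_combination (120 * κ ^ 2 + 480 * κ) * h2 - (16 * κ ^ 2 + 64 * κ - 128) * h15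
  have hL := fun x y => @mul_one_add_lt_mul_one_add_iff (√15 * β) x y hc
  have hG := fun x y => @mul_mul_lt_mul_mul_iff x y (√2 / 2) β hq hβ
  have g1 : -(3 * √2 * β) < γ ↔ -6 < κ := by rw [hγ, e6, hG]
  have g2 : γ < 0 ↔ κ < 0 := by rw [hγ, mul_mul_neg_iff hq hβ]
  have g3 : √2 * β < γ ↔ 2 < κ := by rw [hγ, e2, hG]
  have a1 : α < √15 * β ↔ 8 * B < 0 := by rw [eα, mul_one_add_lt_self_iff hc]
  have a2 : √15 * β < α ↔ 0 < 8 * B := by rw [eα, lt_mul_one_add_self_iff hc]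
  simp only [evenRegion, g1, g2, g3, a1, a2]
  rw [e1, eα, hL, hL]

theorem evenRegion_five_iff (α : ℝ) {β : ℝ} (hβ : 0 < β) (γ : ℝ) :
    evenRegion 5 α β γ ↔
      ∃ ρ, IsCuspRadius 2 (defocusRatio α β) (harmonicRatio 2 β γ) ρ := by
  rw [exists_isCuspRadius_two_iff]
  have hα := eq_of_defocusRatio (α := α) hβ.ne' rfl
  have hγ := eq_of_harmonicRatio_two (γ := γ) hβ.ne' rfl
  generalize defocusRatio α β = B at *
  generalize harmonicRatio 2 β γ = κ at *
  have h15 : √15 ^ 2 = 15 := Real.sq_sqrt (by norm_num)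
  have hq : 0 < √15 / 10 := by positivity
  have hc : 0 < √15 * β := by positivity
  have e1 : alphaOne 5 1 β γ = √15 * β * (1 + cuspLevel 2 κ 1 / 8) := by
    rw [alphaOne, cuspLevel_two_eq, hγ]
    field_simp
    linear_combination 3200 * h15
  have e2 : ∀ s, κ ≠ 0 → √15 * β - alphaTwo5 s β γ =
      √15 * β * (1 + -((4561 + s * (445 * √89)) / (32 * κ ^ 2)) / 8) := by
    intro s hκ
    rw [alphaTwo5, hγ]
    field_simp
    linear_combination ((4670464 + 455680 * s * √89) * (√15 ^ 2 + 15)) * h15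
  have e3 : ∀ s, gammaOne5 s β = (√89 + s * 5) / 4 * (√15 / 10) * β := by
    intro s
    rw [gammaOne5]; ring
  have eα : α = √15 * β * (1 + 8 * B / 8) := by rw [hα]; ring
  have hL := fun x y => @mul_one_add_lt_mul_one_add_iff (√15 * β) x y hc
  have hG := fun x y => @mul_mul_lt_mul_mul_iff x y (√15 / 10) β hq hβ
  have g1 : γ ≤ -gammaOne5 1 β ↔ κ ≤ -((√89 + 5) / 4) := by
    rw [hγ, e3, ← neg_mul, ← neg_mul, mul_mul_le_mul_mul_iff hq hβ]
    norm_num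
  have g2 : -gammaOne5 1 β < γ ↔ -((√89 + 5) / 4) < κ := by
    rw [← not_le, g1, not_le]
  have g3 : γ < 0 ↔ κ < 0 := by rw [hγ, mul_mul_neg_iff hq hβ]
  have g4 : gammaOne5 (-1) β < γ ↔ (√89 - 5) / 4 < κ := by
    rw [hγ, e3, hG]
    norm_num [sub_eq_add_neg]
  have a1 : α < √15 * β ↔ 8 * B < 0 := by rw [eα, mul_one_add_lt_self_iff hc]
  have a2 : alphaOne 5 1 β γ < α ↔ cuspLevel 2 κ 1 < 8 * B := by rw [e1, eα, hL]
  have a3 : α < alphaOne 5 1 β γ ↔ 8 * B < cuspLevel 2 κ 1 := by rw [e1, eα, hL]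
  simp only [evenRegion, g1, g2, g3, g4, a1, a2, a3]
  have h5 := five_lt_sqrt_eightyNine
  refine or_congr (and_congr_right fun h => ?_) (or_congr_right (and_congr_right fun h => ?_))
  · rw [e2 1 (by rintro rfl; linarith), eα, hL, one_mul]
  · rw [e2 (-1) (by rintro rfl; linarith), eα, hL, neg_one_mul, ← sub_eq_add_neg]

theorem evenRegion_six_iff (α : ℝ) {β : ℝ} (hβ : 0 < β) (γ : ℝ) :
    evenRegion 6 α β γ ↔
      ∃ ρ, IsCuspRadius 3 (defocusRatio α β) (harmonicRatio 3 β γ) ρ := by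
  rw [exists_isCuspRadius_three_iff]
  have hα := eq_of_defocusRatio (α := α) hβ.ne' rfl
  have hγ := eq_of_harmonicRatio_three (γ := γ) hβ.ne' rfl
  generalize defocusRatio α β = B at *
  generalize harmonicRatio 3 β γ = κ at *
  have h15 : √15 ^ 2 = 15 := Real.sq_sqrt (by norm_num)
  have h70 : √70 ^ 2 = 70 := Real.sq_sqrt (by norm_num)
  have h3 : √3 ^ 2 = 3 := Real.sq_sqrt (by norm_num)
  have h210 : √210 = √70 * √3 := by rw [← Real.sqrt_mul (by norm_num)]; norm_num
  have hq : 0 < √70 / 35 := by positivity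
  have hc : 0 < √15 * β := by positivity
  have e1 : alphaOne 6 1 β γ = √15 * β * (1 + cuspLevel 3 κ 1 / 8) := by
    rw [alphaOne, cuspLevel_three_eq, hγ]
    field_simp
    linear_combination (4200 * κ ^ 2 + 12600 * κ) * h70 - (19600 * κ ^ 2 + 58800 * κ - 78400) * h15
  have e27 : 35 * √3 * √(2 / 7) = √15 * √70 := by
    rw [mul_assoc, ← Real.sqrt_mul (by norm_num) (2 / 7), ← Real.sqrt_mul (by norm_num) 70,
      show (15 * 70 : ℝ) = 35 ^ 2 * (3 * (2 / 7)) by norm_num,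
      Real.sqrt_mul (by norm_num) (3 * (2 / 7)), Real.sqrt_sq (by norm_num)]
  have e2 : ∀ s, κ ≠ 0 → alphaTwo6 s β γ =
      √15 * β * ((24 * √3 + s * 32) / κ / 8) := by
    intro s hκ
    rw [alphaTwo6, hγ]
    field_simp
    linear_combination (32 * s + 24 * √3) * e27 - 840 * √(2 / 7) * h3
  have e3 : ∀ s, gammaOne6 s β = (√3 + s) * (√70 / 35) * β := by
    intro s
    rw [gammaOne6, h210]; ring
  have eα : α = √15 * β * (1 + 8 * B / 8) := by rw [hα]; ring
  have hL := fun x y => @mul_one_add_lt_mul_one_add_iff (√15 * β) x y hc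
  have hG := fun x y => @mul_mul_lt_mul_mul_iff x y (√70 / 35) β hq hβ
  have g1 : γ ≤ -gammaOne6 1 β ↔ κ ≤ -(√3 + 1) := by
    rw [hγ, e3, ← neg_mul, ← neg_mul, mul_mul_le_mul_mul_iff hq hβ]
  have g2 : -gammaOne6 1 β < γ ↔ -(√3 + 1) < κ := by
    rw [← not_le, g1, not_le]
  have g3 : γ < 0 ↔ κ < 0 := by rw [hγ, mul_mul_neg_iff hq hβ]
  have g4 : gammaOne6 (-1) β < γ ↔ √3 - 1 < κ := by
    rw [hγ, e3, hG]
    norm_num [sub_eq_add_neg]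
  have a1 : α < √15 * β ↔ 8 * B < 0 := by rw [eα, mul_one_add_lt_self_iff hc]
  have a2 : alphaOne 6 1 β γ < α ↔ cuspLevel 3 κ 1 < 8 * B := by rw [e1, eα, hL]
  have a3 : α < alphaOne 6 1 β γ ↔ 8 * B < cuspLevel 3 κ 1 := by rw [e1, eα, hL]
  simp only [evenRegion, g1, g2, g3, g4, a1, a2, a3]
  have h1 := one_lt_sqrt_three
  refine or_congr (and_congr_right fun h => ?_) (or_congr_right (and_congr_right fun h => ?_))
  · rw [e2 1 (by rintro rfl; linarith), eα, ← mul_one_add, hL, one_mul]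
  · rw [e2 (-1) (by rintro rfl; linarith), eα, sub_eq_add_neg, ← mul_neg, ← mul_one_add, ← neg_div,
      hL, neg_one_mul, ← sub_eq_add_neg]

theorem harmonicRatio_neg (m : ℕ) (β γ : ℝ) : harmonicRatio m β (-γ) = -harmonicRatio m β γ := by
  unfold harmonicRatio; ring

theorem alphaOne_neg_one {n : ℕ} (hn : n = 3 ∨ n = 4 ∨ n = 5 ∨ n = 6) (β γ : ℝ) :
    alphaOne n (-1) β γ = alphaOne n 1 β (-γ) := by
  rcases hn with rfl | rfl | rfl | rfl <;> simp only [alphaOne] <;> ring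

/-- The odd region is the even region of `-γ`: rotation by `π / n` turns `γ` into `-γ`. -/
theorem oddRegion_iff_evenRegion_neg {n : ℕ} (hn : n = 3 ∨ n = 4 ∨ n = 5 ∨ n = 6) (α β γ : ℝ) :
    oddRegion n α β γ ↔ evenRegion n α β (-γ) := by
  have h1 := alphaOne_neg_one hn β γ
  have h2 : alphaTwo3 β (-γ) = alphaTwo3 β γ := by unfold alphaTwo3; ring
  have h3 : alphaThree3 β (-γ) = alphaThree3 β γ := by unfold alphaThree3; ring
  have h5 : ∀ s, alphaTwo5 s β (-γ) = alphaTwo5 s β γ := fun s => by unfold alphaTwo5; ring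
  have h6 : ∀ s, alphaTwo6 s β (-γ) = -alphaTwo6 s β γ := fun s => by
    unfold alphaTwo6; rw [div_neg]; ring
  rcases hn with rfl | rfl | rfl | rfl
  · simp only [oddRegion, evenRegion, h1, h2, h3, neg_neg_iff_pos, neg_zero, neg_le (a := γ),
      lt_neg (b := γ)]
    tauto
  · simp only [oddRegion, evenRegion, h1, neg_lt_neg_iff, neg_neg_iff_pos, lt_neg]
    tauto
  · simp only [oddRegion, evenRegion, h1, h5, neg_le_neg_iff, neg_lt_neg_iff, neg_neg_iff_pos,
      lt_neg]
    tauto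
  · simp only [oddRegion, evenRegion, h1, h6, neg_le_neg_iff, neg_lt_neg_iff, neg_neg_iff_pos,
      lt_neg, sub_neg_eq_add, ← sub_eq_add_neg]
    tauto

theorem evenRegion_iff_exists_isCuspRadius {m : ℕ} (hm : m ≤ 3) (α : ℝ) {β : ℝ} (hβ : 0 < β)
    (γ : ℝ) : evenRegion (m + 3) α β γ ↔
      ∃ ρ, IsCuspRadius m (defocusRatio α β) (harmonicRatio m β γ) ρ := by
  interval_cases m
  · exact evenRegion_three_iff α hβ γ
  · exact evenRegion_four_iff α hβ γ
  · exact evenRegion_five_iff α hβ γ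
  · exact evenRegion_six_iff α hβ γ

theorem oddRegion_iff_exists_isCuspRadius {m : ℕ} (hm : m ≤ 3) (α : ℝ) {β : ℝ} (hβ : 0 < β)
    (γ : ℝ) : oddRegion (m + 3) α β γ ↔
      ∃ ρ, IsCuspRadius m (defocusRatio α β) (-harmonicRatio m β γ) ρ := by
  rw [oddRegion_iff_evenRegion_neg (by omega), evenRegion_iff_exists_isCuspRadius hm α hβ,
    harmonicRatio_neg]

/-- For `n = 3` the levels `8 B` of `σ > 0` lie above `σ²` and those of `-σ` below; for `n = 4` the
levels of `σ > 0` are positive and those of `-σ` negative. -/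
theorem not_exists_isCuspRadius_and_neg {m : ℕ} (hm : m = 0 ∨ m = 1) (B σ : ℝ) :
    ¬((∃ ρ, IsCuspRadius m B σ ρ) ∧ ∃ ρ, IsCuspRadius m B (-σ) ρ) := by
  rintro ⟨h1, h2⟩
  rcases hm with rfl | rfl
  · rw [exists_isCuspRadius_zero_iff] at h1 h2
    rw [neg_sq] at h2
    rcases h1 with h1 | h1 | h1 <;> rcases h2 with h2 | h2 | h2 <;> linarith [h1.1, h2.1]
  · rw [exists_isCuspRadius_one_iff] at h1 h2
    rcases h1 with h1 | h1 <;> rcases h2 with h2 | h2 <;> linarith [h1.1, h2.1]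

/-- For `n = 5, 6` and `-σ < 0` the admissible radii start at `0`, where the level function
vanishes, so all levels reached are negative. Conversely, at a cusp radius of `σ` the level function
of `-σ` is below `8 B`, and so it passes through a negative value `8 B` on its decreasing part. -/
theorem exists_isCuspRadius_neg_iff_of_pos {m : ℕ} (hm : m = 2 ∨ m = 3) {B σ : ℝ} (hσ : 0 < σ)
    (h : ∃ ρ, IsCuspRadius m B σ ρ) : (∃ ρ, IsCuspRadius m B (-σ) ρ) ↔ B < 0 := by
  constructor
  · intro h
    have h5 := five_lt_sqrt_eightyNine
    have h1 := one_lt_sqrt_three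
    rcases hm with rfl | rfl
    · rw [exists_isCuspRadius_two_iff] at h
      rcases h with h | h | h <;> linarith [h.1]
    · rw [exists_isCuspRadius_three_iff] at h
      rcases h with h | h | h <;> linarith [h.1]
  · intro hB
    obtain ⟨ρ, h0, h1, hL, -⟩ := h
    obtain ⟨b, hb0, hb⟩ : ∃ b, 0 < b ∧ ∀ t, 0 < t → (0 < cuspSlope m (-σ) t ↔ t < b) := by
      rcases hm with rfl | rfl
      · refine ⟨(√89 + 5) / 4 / (- -σ), by rw [neg_neg]; positivity, fun t ht => ?_⟩
        exact cuspSlope_two_pos_iff_of_neg (neg_lt_zero.2 hσ) ht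
      · refine ⟨√((√3 + 1) / (- -σ)), by rw [neg_neg]; positivity, fun t ht => ?_⟩
        exact cuspSlope_three_pos_iff_of_neg (neg_lt_zero.2 hσ) ht
    -- only the term of the level function that is linear in `σ` changes its sign
    have hlt : cuspLevel m (-σ) ρ < 8 * B := by
      have hpos : 0 < 4 * ((m : ℝ) + 3) * σ * ρ ^ (m + 1) := by positivity
      have hdiff : cuspLevel m σ ρ - cuspLevel m (-σ) ρ = 4 * ((m : ℝ) + 3) * σ * ρ ^ (m + 1) := by
        unfold cuspLevel; ring
      linarith
    exact exists_isCuspRadius_of_cuspLevel_lt (by omega) (neg_lt_zero.2 hσ)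
      (lt_min one_pos hb0) (min_le_left 1 b)
      (fun t ht ht1 => by rw [hb t ht, lt_min_iff, and_iff_right ht1]) hB h0 h1 hlt

theorem gammaOne5_pos {β : ℝ} (hβ : 0 < β) : 0 < gammaOne5 (-1) β ∧ 0 < gammaOne5 1 β := by
  have := five_lt_sqrt_eightyNine
  have h1 : 0 < √89 + -1 * 5 := by linarith
  unfold gammaOne5
  constructor <;> positivity

theorem gammaOne6_pos {β : ℝ} (hβ : 0 < β) : 0 < gammaOne6 (-1) β ∧ 0 < gammaOne6 1 β := by
  have h1 : 0 < √210 + -1 * √70 := by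
    have := Real.sqrt_lt_sqrt (show (0 : ℝ) ≤ 70 by norm_num) (show (70 : ℝ) < 210 by norm_num)
    linarith
  unfold gammaOne6
  constructor <;> positivity

/-- The double region is the part with `α < √15 β` of the even region for `γ > 0` and of the odd
region for `γ < 0`. -/
theorem doubleRegion_iff {n : ℕ} (hn : n = 5 ∨ n = 6) {β : ℝ} (hβ : 0 < β) (α γ : ℝ) :
    doubleRegion n α β γ ↔ (0 < γ ∧ evenRegion n α β γ ∧ α < √15 * β) ∨
      (γ < 0 ∧ oddRegion n α β γ ∧ α < √15 * β) := by
  rcases hn with rfl | rfl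
  · obtain ⟨h1, h2⟩ := gammaOne5_pos hβ
    simp only [doubleRegion, evenRegion, oddRegion, lt_min_iff]
    constructor
    · rintro (⟨a, b, c, d⟩ | ⟨a, b, c, d⟩)
      · exact Or.inl ⟨h1.trans a, Or.inr (Or.inr ⟨a, b, c⟩), d⟩
      · exact Or.inr ⟨by linarith, Or.inl ⟨a, b, c⟩, d⟩
    · rintro (⟨h, H | H | H, d⟩ | ⟨h, H | H | H, d⟩)
      · linarith [H.1]
      · linarith [H.2.1]
      · exact Or.inl ⟨H.1, H.2.1, H.2.2, d⟩
      · exact Or.inr ⟨H.1, H.2.1, H.2.2, d⟩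
      · linarith [H.1]
      · linarith [H.1]
  · obtain ⟨h1, h2⟩ := gammaOne6_pos hβ
    simp only [doubleRegion, evenRegion, oddRegion, lt_min_iff]
    constructor
    · rintro (⟨a, b, d, c⟩ | ⟨a, b, d, c⟩)
      · exact Or.inr ⟨by linarith, Or.inl ⟨a, b, c⟩, d⟩
      · exact Or.inl ⟨h1.trans a, Or.inr (Or.inr ⟨a, b, c⟩), d⟩
    · rintro (⟨h, H | H | H, d⟩ | ⟨h, H | H | H, d⟩)
      · linarith [H.1]
      · linarith [H.2.1]
      · exact Or.inr ⟨H.1, H.2.1, d, H.2.2⟩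
      · exact Or.inl ⟨H.1, H.2.1, d, H.2.2⟩
      · linarith [H.1]
      · linarith [H.1]

theorem harmonicRatio_pos_iff (m : ℕ) {β : ℝ} (hβ : 0 < β) (γ : ℝ) :
    0 < harmonicRatio m β γ ↔ 0 < γ := by
  have : harmonicRatio m β γ =
      γ * (√(2 * ((m + 3 : ℕ) + 1)) * (m + 3) * (m + 2) / (2 * (6 * √5 * β))) := by
    unfold harmonicRatio; ring
  rw [this, mul_pos_iff_of_pos_right (by positivity)]

theorem defocusRatio_neg_iff (α : ℝ) {β : ℝ} (hβ : 0 < β) :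
    defocusRatio α β < 0 ↔ α < √15 * β := by
  have hc : 0 < √15 * β := by positivity
  have h := mul_one_add_lt_self_iff (x := 8 * defocusRatio α β) hc
  rw [mul_div_cancel_left₀ _ (by norm_num), ← eq_of_defocusRatio hβ.ne' rfl] at h
  rw [h]
  constructor <;> intro h <;> linarith

theorem doubleRegion_iff_exists_isCuspRadius {m : ℕ} (hm : m ≤ 3) (α : ℝ) {β : ℝ} (hβ : 0 < β)
    (γ : ℝ) : doubleRegion (m + 3) α β γ ↔
      (∃ ρ, IsCuspRadius m (defocusRatio α β) (harmonicRatio m β γ) ρ) ∧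
      ∃ ρ, IsCuspRadius m (defocusRatio α β) (-harmonicRatio m β γ) ρ := by
  by_cases h01 : m = 0 ∨ m = 1
  · refine iff_of_false ?_ (not_exists_isCuspRadius_and_neg h01 _ _)
    rcases h01 with rfl | rfl <;> exact id
  have h23 : m = 2 ∨ m = 3 := by omega
  rw [doubleRegion_iff (by omega) hβ, evenRegion_iff_exists_isCuspRadius hm α hβ,
    oddRegion_iff_exists_isCuspRadius hm α hβ, ← defocusRatio_neg_iff α hβ,
    ← harmonicRatio_pos_iff m hβ γ, ← neg_pos (a := γ), ← harmonicRatio_pos_iff m hβ (-γ),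
    harmonicRatio_neg]
  generalize defocusRatio α β = B
  generalize harmonicRatio m β γ = κ
  constructor
  · rintro (⟨h, hE, hB⟩ | ⟨h, hO, hB⟩)
    · exact ⟨hE, (exists_isCuspRadius_neg_iff_of_pos h23 h hE).2 hB⟩
    · have := (exists_isCuspRadius_neg_iff_of_pos h23 h hO).2 hB
      rw [neg_neg] at this
      exact ⟨this, hO⟩
  · rintro ⟨hE, hO⟩
    have hκ : κ ≠ 0 := by
      obtain ⟨ρ, -, -, -, hS⟩ := hE
      exact ne_zero_of_cuspSlope_pos hS
    rcases lt_or_gt_of_ne hκ with h | h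
    · have h := neg_pos.2 h
      exact Or.inr ⟨h, hO, (exists_isCuspRadius_neg_iff_of_pos h23 h hO).1 (by rwa [neg_neg])⟩
    · exact Or.inl ⟨h, hE, (exists_isCuspRadius_neg_iff_of_pos h23 h hE).1 hO⟩

theorem mainTheorem1 (n : ℕ) (hn : n = 3 ∨ n = 4 ∨ n = 5 ∨ n = 6) (α β γ : ℝ) :
    -- the number of saddle cusps of Gauss inside the unit pupil
    ((n = 3 ∨ n = 4) →
      (saddleCusps n α β γ).encard = 0 ∨ (saddleCusps n α β γ).encard = n) ∧
    ((n = 5 ∨ n = 6) →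
      (saddleCusps n α β γ).encard = 0 ∨ (saddleCusps n α β γ).encard = n ∨
        (saddleCusps n α β γ).encard = 2 * n) ∧
    -- their distribution
    ((saddleCusps n α β γ).encard = n →
      ∃ r φ : ℝ, 0 < r ∧ r < 1 ∧ saddleCusps n α β γ = uniformRing n r φ) ∧
    ((saddleCusps n α β γ).encard = 2 * n →
      ∃ r₁ r₂ φ₁ φ₂ : ℝ, 0 < r₁ ∧ r₁ < 1 ∧ 0 < r₂ ∧ r₂ < 1 ∧ r₁ ≠ r₂ ∧
        saddleCusps n α β γ = uniformRing n r₁ φ₁ ∪ uniformRing n r₂ φ₂) ∧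
    -- the parameter regions for each configuration
    (0 < β →
      ((∃ r : ℝ, 0 < r ∧ r < 1 ∧ uniformRing n r 0 ⊆ saddleCusps n α β γ) ↔
        evenRegion n α β γ) ∧
      ((∃ r : ℝ, 0 < r ∧ r < 1 ∧ uniformRing n r (Real.pi / n) ⊆ saddleCusps n α β γ) ↔
        oddRegion n α β γ) ∧
      ((saddleCusps n α β γ).encard = 2 * n ↔ doubleRegion n α β γ)) := by
  obtain ⟨m, hm, rfl⟩ : ∃ m, m ≤ 3 ∧ n = m + 3 := ⟨n - 3, by omega, by omega⟩
  have hcases := saddleCusps_encard_cases m α β γ fun B σ r s => IsCuspRadius.unique hm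
  have h0 : (0 : ℕ∞) ≠ (m + 3 : ℕ) := by
    exact_mod_cast (by omega : 0 ≠ m + 3)
  have h02 : (0 : ℕ∞) ≠ 2 * (m + 3 : ℕ) := by
    exact_mod_cast (by omega : 0 ≠ 2 * (m + 3))
  have h12 : ((m + 3 : ℕ) : ℕ∞) ≠ 2 * (m + 3 : ℕ) := by
    exact_mod_cast (by omega : m + 3 ≠ 2 * (m + 3))
  refine ⟨fun h => ?_, fun _ => ?_, fun h => ?_, fun h => ?_, fun hβ => ⟨?_, ?_, ?_⟩⟩
  · rcases hcases with H | H | H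
    · exact Or.inl H.1
    · exact Or.inr H.1
    · exact absurd H.2.2.2 (not_exists_isCuspRadius_and_neg (by omega) _ _)
  · rcases hcases with H | H | H
    · exact Or.inl H.1
    · exact Or.inr (Or.inl H.1)
    · exact Or.inr (Or.inr H.1)
  · rcases hcases with H | H | H
    · exact absurd (H.1.symm.trans h) h0
    · exact H.2.1
    · exact absurd (h.symm.trans H.1) h12
  · rcases hcases with H | H | H
    · exact absurd (H.1.symm.trans h) h02
    · exact absurd (H.1.symm.trans h) h12
    · exact H.2.1
  · rw [exists_uniformRing_zero_subset_iff m α hβ.ne' γ,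
      evenRegion_iff_exists_isCuspRadius hm α hβ]
  · rw [exists_uniformRing_pi_div_subset_iff m α hβ.ne' γ,
      oddRegion_iff_exists_isCuspRadius hm α hβ]
  · rw [doubleRegion_iff_exists_isCuspRadius hm α hβ]
    rcases hcases with H | H | H
    · exact iff_of_false (fun h => h02 (H.1.symm.trans h)) (fun h => H.2 ⟨hβ.ne', h⟩)
    · exact iff_of_false (fun h => h12 (H.1.symm.trans h)) (fun h => H.2.2 ⟨hβ.ne', h⟩)
    · exact iff_of_true H.1 H.2.2.2
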